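/- **Setting.** Let $c,\lambda,g>0$ and consider an irrotational deep-water Stokes wave of speed $c$ and wavelength $\lambda$, in the frame moving with the wave: a differentiable free surface $y=\eta(x)$, and a velocity field $(u,v)$ and a pressure $P$ that are $C^1$ in the fluid domain $D=\{(x,y): y<\eta(x)\}$ and continuous up to the free surface, with $(u,v)$ bounded, such that $$(u-c)u_x+vu_y=-P_x,\quad (u-c)v_x+vv_y=-P_y-g,\quad u_x+v_y=0,\quad u_y-v_x=0\quad\text{in } D,$$ $$v=(u-c)\eta_x,\quad P=P_{\rm atm}\quad\text{on } y=\eta(x),\qquad (u,v)\to(0,0)\ \text{ as } y\to-\infty \text{ uniformly in } x,$$ and $u<c$ for $y\le\eta(x)$. The functions $\eta,u,v$ are $\lambda$-periodic in $x$; $\eta,u,P$ are even in $x$; $\eta$ is strictly increasing on $[-\lambda/2,0]$ and strictly decreasing on $[0,\lambda/2]$. Let $\psi$ be the stream function ($\psi_y=u-c$, $\psi_x=-v$ in $D$, continuous up to the free surface, $\psi=0$ on $y=\eta(x)$), let $\varphi$ be a velocity potential ($\varphi_x=u-c$, $\varphi_y=v$ in $D$), and let $h(x+iy)=\varphi(x,y)+i\psi(x,y)$.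 For $p>0$ and $x_0\in\mathbb R$ let $y_0=\xi_p(x_0)<\eta(x_0)$ be the point with $\psi(x_0,y_0)=p$, and let $(x(t),y(t))$ be the path of the particle starting there: $$x'(t)=u(x(t)-ct,y(t)),\quad y'(t)=v(x(t)-ct,y(t)),\qquad (x(0),y(0))=(x_0,y_0).$$ Its streamline time-period is the number $\mathcal T>0$ with $x(\mathcal T)-c\mathcal T=x_0-\lambda$. Set $$\mathcal E(p,x_0)=\frac12\int_0^{\mathcal T}\big[x'(t)^2+y'(t)^2\big]\,dt,\qquad \mathbb E(p,x_0)=\frac12\int_0^{\mathcal T}\big[(x'(t)-c)^2+y'(t)^2\big]\,dt.$$ **Theorem 5.1.** A stream function and a velocity potential exist, and all these objects are well defined: $h$ is a bijection of $D$ onto the upper half plane $\Omega=\{q+ip: p>0\}$; for all $p>0$ and $x_0\in\mathbb R$ the point $y_0=\xi_p(x_0)$ exists and is unique; every particle in $D$ has a unique global path; and $\mathcal T$ exists, is unique and depends only on $p$. For $p>0$ the total kinetic energy $\mathcal E(p,x_0)$ depends only on the streamline $p$ and not on $x_0$. As a function of $p\in(0,\infty)$, $\mathcal E$ is positive, convex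 and non-increasing, and $\log\mathcal E$ is convex. Moreover $J=1+c\,(h^{-1})'$ is analytic on $\Omega$ and, with $k=2\pi/(c\lambda)$, there is an analytic function $\mathcal J$ on the open unit disk with $\mathcal J(e^{ikw})=J(w)$ for all $w\in\Omega$ and $$\mathcal E(p)=\frac{c\lambda}{2}\,M_2(\mathcal J,e^{-kp})^2\quad(p>0),\qquad M_2(F,r)=\Big(\frac1{2\pi}\int_0^{2\pi}|F(re^{i\theta})|^2\,d\theta\Big)^{1/2}.$$ Finally, $\mathbb E(p,x_0)=c\lambda/2$ for all $p>0$ and $x_0\in\mathbb R$. -/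

import Mathlib

open Set Filter Topology

noncomputable section

/-- The partial derivative in the first variable. -/
def partialX (f : ℝ → ℝ → ℝ) (x y : ℝ) : ℝ := deriv (fun s => f s y) x

/-- The partial derivative in the second variable. -/
def partialY (f : ℝ → ℝ → ℝ) (x y : ℝ) : ℝ := deriv (fun s => f x s) y

/-- The open region below the graph of `η`. -/
def belowGraph (η : ℝ → ℝ) : Set (ℝ × ℝ) := {z | z.2 < η z.1}

/-- The region on or below the graph of `η` (the closure of the former for continuous `η`). -/
def onOrBelowGraph (η : ℝ → ℝ) : Set (ℝ × ℝ) := {z | z.2 ≤ η z.1}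

/-- An irrotational deep-water Stokes wave, written in the frame moving with the wave, in which
the flow is steady. The crest is at `x = 0`. -/
structure DeepWaterStokesWave where
  /-- the wave speed -/
  c : ℝ
  /-- the wavelength -/
  L : ℝ
  /-- the gravitational acceleration -/
  g : ℝ
  /-- the atmospheric pressure -/
  Patm : ℝ
  /-- the free surface -/
  η : ℝ → ℝ
  /-- the horizontal velocity -/
  u : ℝ → ℝ → ℝ
  /-- the vertical velocity -/
  v : ℝ → ℝ → ℝ
  /-- the pressure -/
  P : ℝ → ℝ → ℝ
  c_pos : 0 < c
  L_pos : 0 < L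
  g_pos : 0 < g
  -- regularity
  differentiable_η : Differentiable ℝ η
  contDiffOn_u : ContDiffOn ℝ 1 (fun z : ℝ × ℝ => u z.1 z.2) (belowGraph η)
  contDiffOn_v : ContDiffOn ℝ 1 (fun z : ℝ × ℝ => v z.1 z.2) (belowGraph η)
  contDiffOn_P : ContDiffOn ℝ 1 (fun z : ℝ × ℝ => P z.1 z.2) (belowGraph η)
  continuousOn_u : ContinuousOn (fun z : ℝ × ℝ => u z.1 z.2) (onOrBelowGraph η)
  continuousOn_v : ContinuousOn (fun z : ℝ × ℝ => v z.1 z.2) (onOrBelowGraph η)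
  continuousOn_P : ContinuousOn (fun z : ℝ × ℝ => P z.1 z.2) (onOrBelowGraph η)
  bounded : ∃ B : ℝ, ∀ x y, y < η x → |u x y| ≤ B ∧ |v x y| ≤ B
  -- the steady Euler equations, incompressibility and irrotationality
  euler_x : ∀ x y, y < η x →
    (u x y - c) * partialX u x y + v x y * partialY u x y = -partialX P x y
  euler_y : ∀ x y, y < η x →
    (u x y - c) * partialX v x y + v x y * partialY v x y = -partialY P x y - g
  incompressible : ∀ x y, y < η x → partialX u x y + partialY v x y = 0
  irrotational : ∀ x y, y < η x → partialY u x y - partialX v x y = 0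
  -- the kinematic and the dynamic boundary condition
  kinematic : ∀ x, v x (η x) = (u x (η x) - c) * deriv η x
  dynamic : ∀ x, P x (η x) = Patm
  -- the water is at rest at great depths, uniformly in the horizontal variable
  u_tendsto : TendstoUniformly (fun y x => u x y) (fun _ => 0) atBot
  v_tendsto : TendstoUniformly (fun y x => v x y) (fun _ => 0) atBot
  -- no stagnation points, up to the free surface
  u_lt_c : ∀ x y, y ≤ η x → u x y < c
  -- periodicity
  η_periodic : ∀ x, η (x + L) = η x
  u_periodic : ∀ x y, y ≤ η x → u (x + L) y = u x y
  v_periodic : ∀ x y, y ≤ η x → v (x + L) y = v x y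
  -- symmetry about the crest
  η_even : ∀ x, η (-x) = η x
  u_even : ∀ x y, y ≤ η x → u (-x) y = u x y
  P_even : ∀ x y, y ≤ η x → P (-x) y = P x y
  -- strict monotonicity between successive crests and troughs
  η_strictMonoOn : StrictMonoOn η (Icc (-(L / 2)) 0)
  η_strictAntiOn : StrictAntiOn η (Icc 0 (L / 2))

/-- The open upper half plane, in the variable `q + i p`. -/
def upperHalf : Set ℂ := {w | 0 < w.im}

/-- The integral mean `M_s(F, r) = ((1 / 2π) ∫₀^{2π} |F(r e^{iθ})|^s dθ)^{1/s}`. -/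
def integralMean (s : ℝ) (F : ℂ → ℂ) (r : ℝ) : ℝ :=
  ((1 / (2 * Real.pi)) *
    ∫ θ in (0 : ℝ)..(2 * Real.pi), ‖F (r * Complex.exp (θ * Complex.I))‖ ^ s) ^ (1 / s)

/-- The map `x + i y ↦ φ(x, y) + i ψ(x, y)`. -/
def hodograph (φ ψ : ℝ → ℝ → ℝ) (z : ℂ) : ℂ :=
  (φ z.re z.im : ℂ) + (ψ z.re z.im : ℂ) * Complex.I

namespace DeepWaterStokesWave

variable (W : DeepWaterStokesWave)

/-- The fluid domain in the moving frame, as a region of the complex plane `z = x + i y`. -/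
def fluidDomain : Set ℂ := {z | z.im < W.η z.re}

/-- `ψ` is the stream function: `ψ_y = u - c` and `ψ_x = -v` in the fluid domain, and `ψ` is
continuous up to the free surface and vanishes there. -/
structure IsStreamFunction (ψ : ℝ → ℝ → ℝ) : Prop where
  hasDerivAt_x : ∀ x y, y < W.η x → HasDerivAt (fun s => ψ s y) (-W.v x y) x
  hasDerivAt_y : ∀ x y, y < W.η x → HasDerivAt (fun s => ψ x s) (W.u x y - W.c) y
  continuousOn : ContinuousOn (fun z : ℝ × ℝ => ψ z.1 z.2) (onOrBelowGraph W.η)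
  surface : ∀ x, ψ x (W.η x) = 0

/-- `φ` is a velocity potential, that is, a harmonic conjugate of the stream function:
`φ_x = ψ_y = u - c` and `φ_y = -ψ_x = v` in the fluid domain. It is determined up to an additive
constant. -/
structure IsVelocityPotential (φ : ℝ → ℝ → ℝ) : Prop where
  hasDerivAt_x : ∀ x y, y < W.η x → HasDerivAt (fun s => φ s y) (W.u x y - W.c) x
  hasDerivAt_y : ∀ x y, y < W.η x → HasDerivAt (fun s => φ x s) (W.v x y) y

/-- `t ↦ (X t, Y t)` is the path, in the physical frame, of the fluid particle that is at
`(x₀, y₀)` at time `0`. -/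
structure IsParticlePath (x₀ y₀ : ℝ) (X Y : ℝ → ℝ) : Prop where
  mem : ∀ t, Y t < W.η (X t - W.c * t)
  hasDerivAt_X : ∀ t, HasDerivAt X (W.u (X t - W.c * t) (Y t)) t
  hasDerivAt_Y : ∀ t, HasDerivAt Y (W.v (X t - W.c * t) (Y t)) t
  X_zero : X 0 = x₀
  Y_zero : Y 0 = y₀

/-- `T` is a streamline time-period of a particle with horizontal coordinate `X`: a positive time
after which, in the moving frame, the particle has moved by one wavelength. -/
def IsStreamlineTimePeriod (X : ℝ → ℝ) (T : ℝ) : Prop :=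
  0 < T ∧ X T - W.c * T = X 0 - W.L

/-- The kinetic energy `½ ∫₀^T (x'² + y'²) dt` accumulated along a path over the time `T`. -/
def totalKineticEnergy (X Y : ℝ → ℝ) (T : ℝ) : ℝ :=
  1 / 2 * ∫ t in (0 : ℝ)..T, ((deriv X t) ^ 2 + (deriv Y t) ^ 2)

/-- The moving-frame kinetic energy `½ ∫₀^T ((x' - c)² + y'²) dt` along a path. -/
def movingTotalKineticEnergy (X Y : ℝ → ℝ) (T : ℝ) : ℝ :=
  1 / 2 * ∫ t in (0 : ℝ)..T, ((deriv X t - W.c) ^ 2 + (deriv Y t) ^ 2)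

/-- The function `1 + c (h⁻¹)'`, where `h⁻¹` is the inverse of `h` on the fluid domain. -/
def energyFunction (h : ℂ → ℂ) (w : ℂ) : ℂ :=
  1 + (W.c : ℂ) * deriv (Function.invFunOn h W.fluidDomain) w

/-- The wave number `k = 2π / (cλ)` in the hodograph plane. -/
def waveNumber : ℝ := 2 * Real.pi / (W.c * W.L)

end DeepWaterStokesWave

end

noncomputable section

/-! The complex velocity `f = (u - c) - iv` is holomorphic, and `h = φ + iψ` is a primitive of it.
Since `u ≤ c - δ`, `ψ` falls at rate at least `δ` along verticals, so every streamline is a graph,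
and `φ` falls at rate at least `δ` along each streamline. Hence `h` maps each streamline `ψ = p`
bijectively onto the line `Im w = p` (`bijOn_hodograph`).

In the moving frame a particle satisfies `z' = conj f(z)`, so `(h ∘ z)' = f · conj f = |f|²` is
real: `ψ` is conserved and `q = φ` solves the separable equation `q' = |f|²`. Paths are therefore
explicit (`isParticlePath_iff`). A shift by one wavelength to the left raises `q` by `cλ`, so the
period is the integral of `dq / |f|²` over one period in `q`. The substitution `dq = |f|² dt` turns
the moving-frame energy into half of `cλ`. Since `x' - iy' = f + c` and `J = 1 + c/f`, it turns the
physical energy into half the integral of `|J|²` over a period (`IsParticlePath.period_and_energy`).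
Periodicity removes the dependence on the starting point.

`J` is `cλ`-periodic and bounded, so it descends through `e^{ikw}` to the disk, the puncture being
removable. Parseval gives `𝓔(p) = (cλ/2) ∑ |aₙ|² e^{-2knp}`. Such a series is non-increasing,
log-convex by Hölder, hence convex, and positive unless `J` vanishes identically; that would force
`v = 0` and a flat surface. -/

/-! ### Parseval's identity and series of decaying exponentials. -/

theorem integral_exp_int_mul_I (n : ℤ) :
    ∫ θ in (0 : ℝ)..(2 * Real.pi), Complex.exp (n * (θ * Complex.I)) =
      if n = 0 then (2 * Real.pi : ℂ) else 0 := by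
  split_ifs with hn
  · simp [hn]
  · have hc : (n : ℂ) * Complex.I ≠ 0 := by simp [hn]
    have := integral_exp_mul_complex (a := 0) (b := 2 * Real.pi) hc
    have h2 : (n : ℂ) * Complex.I * ((2 * Real.pi : ℝ) : ℂ) = n * (2 * Real.pi * Complex.I) := by
      push_cast; ring
    rw [h2, Complex.exp_int_mul_two_pi_mul_I] at this
    simp only [Complex.ofReal_zero, mul_zero, Complex.exp_zero, sub_self, zero_div] at this
    rw [← this]
    congr 1
    funext θ
    congr 1
    ring

/-- **Parseval's identity** on a circle inside the disk of convergence of a power series. -/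
theorem hasSum_sq_norm_coeff_circle {F : ℂ → ℂ} {a : ℕ → ℂ}
    (hF : ∀ z ∈ Metric.ball (0 : ℂ) 1, HasSum (fun n => a n * z ^ n) (F z)) {r : ℝ}
    (hr0 : 0 ≤ r) (hr1 : r < 1) :
    HasSum (fun n => ‖a n‖ ^ 2 * r ^ (2 * n))
      ((1 / (2 * Real.pi)) *
        ∫ θ in (0 : ℝ)..(2 * Real.pi), ‖F (r * Complex.exp (θ * Complex.I))‖ ^ 2) := by
  have hmem (θ : ℝ) : (r * Complex.exp (θ * Complex.I) : ℂ) ∈ Metric.ball (0 : ℂ) 1 := by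
    simp [abs_of_nonneg hr0, hr1]
  have hs : Summable fun n => ‖a n‖ * r ^ n := by
    have := (hF (r * Complex.exp ((0 : ℝ) * Complex.I)) (hmem 0)).summable.norm
    simpa [abs_of_nonneg hr0] using this
  have hs2 : Summable fun x : ℕ × ℕ => (‖a x.1‖ * r ^ x.1) * (‖a x.2‖ * r ^ x.2) :=
    hs.mul_of_nonneg hs (fun n => by positivity) (fun n => by positivity)
  -- The terms of the double series for `F · conj F` on the circle. Their norms do not depend on
  -- `θ`, so they dominate themselves and the series can be integrated termwise; only the diagonal
  -- survives.
  let G : ℕ × ℕ → ℝ → ℂ := fun x θ =>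
    (a x.1 * r ^ x.1 * (starRingEnd ℂ (a x.2) * r ^ x.2)) *
      Complex.exp (((x.1 : ℤ) - (x.2 : ℤ) : ℤ) * (θ * Complex.I))
  have hGc (x) : Continuous (G x) := by fun_prop
  have hGn (x θ) : ‖G x θ‖ = (‖a x.1‖ * r ^ x.1) * (‖a x.2‖ * r ^ x.2) := by
    have : ‖Complex.exp (((x.1 : ℤ) - (x.2 : ℤ) : ℤ) * (θ * Complex.I))‖ = 1 := by
      have := Complex.norm_exp_ofReal_mul_I (((x.1 : ℤ) - (x.2 : ℤ) : ℤ) * θ)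
      rw [← this]; congr 2; push_cast; ring
    simp only [G, norm_mul, this]
    simp [abs_of_nonneg hr0]
  have hGs (θ : ℝ) : HasSum (fun x => G x θ)
      ((‖F (r * Complex.exp (θ * Complex.I))‖ ^ 2 : ℝ) : ℂ) := by
    have h1 := hF _ (hmem θ)
    have h2 : HasSum (fun n => starRingEnd ℂ (a n * (r * Complex.exp (θ * Complex.I)) ^ n))
        (starRingEnd ℂ (F (r * Complex.exp (θ * Complex.I)))) := by
      rwa [Complex.hasSum_conj']
    have h3 := h1.mul h2 (by
      refine Summable.of_norm (hs2.congr fun x => ?_)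
      simp [abs_of_nonneg hr0])
    convert! h3 using 1
    · funext x
      have : Complex.exp (((x.1 : ℤ) - (x.2 : ℤ) : ℤ) * (θ * Complex.I)) =
          Complex.exp (θ * Complex.I) ^ x.1 *
            (starRingEnd ℂ (Complex.exp (θ * Complex.I))) ^ x.2 := by
        rw [← Complex.exp_conj, ← Complex.exp_nat_mul, ← Complex.exp_nat_mul, ← Complex.exp_add]
        congr 1
        simp
        ring
      simp only [G, this, map_mul, map_pow, Complex.conj_ofReal]
      ring
    · rw [Complex.mul_conj, Complex.normSq_eq_norm_sq]
  have hI : HasSum (fun x => ∫ θ in (0 : ℝ)..(2 * Real.pi), G x θ)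
      (∫ θ in (0 : ℝ)..(2 * Real.pi),
        ((‖F (r * Complex.exp (θ * Complex.I))‖ ^ 2 : ℝ) : ℂ)) := by
    refine intervalIntegral.hasSum_integral_of_dominated_convergence
      (fun x _ => (‖a x.1‖ * r ^ x.1) * (‖a x.2‖ * r ^ x.2))
      (fun x => (hGc x).aestronglyMeasurable) (fun x => ?_) ?_ ?_ ?_
    · exact .of_forall fun θ _ => (hGn x θ).le
    · exact .of_forall fun θ _ => hs2
    · exact intervalIntegrable_const
    · exact .of_forall fun θ _ => hGs θ
  have hval (x : ℕ × ℕ) : ∫ θ in (0 : ℝ)..(2 * Real.pi), G x θ =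
      if x.1 = x.2 then ((2 * Real.pi * (‖a x.1‖ ^ 2 * r ^ (2 * x.1)) : ℝ) : ℂ) else 0 := by
    simp only [G]
    rw [intervalIntegral.integral_const_mul, integral_exp_int_mul_I]
    have : ((x.1 : ℤ) - (x.2 : ℤ) = 0) ↔ x.1 = x.2 := by omega
    simp only [this]
    split_ifs with h
    · rw [← h]
      have := Complex.mul_conj (a x.1)
      rw [Complex.normSq_eq_norm_sq] at this
      push_cast at this ⊢
      rw [← this]; ring
    · simp
  have hd : Function.Injective fun n : ℕ => (n, n) := fun a b h => by simpa using h
  rw [← hd.hasSum_iff] at hI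
  · rw [intervalIntegral.integral_ofReal] at hI
    have h4 : HasSum (fun n => (2 * Real.pi * (‖a n‖ ^ 2 * r ^ (2 * n)) : ℝ))
        (∫ θ in (0 : ℝ)..(2 * Real.pi), ‖F (r * Complex.exp (θ * Complex.I))‖ ^ 2) := by
      rw [← Complex.hasSum_ofReal]
      convert hI using 1
      funext n
      simp [hval]
    have h5 := h4.mul_left (1 / (2 * Real.pi))
    convert! h5 using 1
    funext n
    field_simp
  · intro x hx
    rw [hval, if_neg]
    rintro h
    exact hx ⟨x.1, by ext <;> simp [h]⟩

/-- A convergent series of positive multiples of decaying exponentials is antitone. -/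
theorem antitoneOn_of_hasSum_exp {b : ℕ → ℝ} {s : ℝ} {E : ℝ → ℝ} (hb : ∀ n, 0 ≤ b n) (hs : 0 ≤ s)
    (hE : ∀ p > 0, HasSum (fun n => b n * Real.exp (-(s * n * p))) (E p)) :
    AntitoneOn E (Ioi 0) := by
  intro p hp q hq hpq
  refine hasSum_le (fun n => ?_) (hE q hq) (hE p hp)
  have := hb n
  gcongr

/-- The logarithm of a convergent series of positive multiples of exponentials is convex. -/
theorem convexOn_log_of_hasSum_exp {b : ℕ → ℝ} {s : ℝ} {E : ℝ → ℝ} (hb : ∀ n, 0 ≤ b n)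
    (hE : ∀ p > 0, HasSum (fun n => b n * Real.exp (-(s * n * p))) (E p))
    (hpos : ∀ p > 0, 0 < E p) :
    ConvexOn ℝ (Ioi 0) fun p => Real.log (E p) := by
  rw [convexOn_iff_forall_pos]
  refine ⟨convex_Ioi 0, fun p hp q hq α β hα hβ hαβ => ?_⟩
  have hp' : 0 < p := hp
  have hq' : 0 < q := hq
  have hpq : 0 < α * p + β * q := by positivity
  -- Each term at `αp + βq` is the product of the `α`-th power of the term at `p` and the `β`-th
  -- power of the term at `q`, so Hölder with exponents `1/α` and `1/β` gives `E(αp + βq) ≤ E(p)^α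
  -- E(q)^β`.
  have hconj : (1 / α).HolderConjugate (1 / β) := by
    rw [Real.holderConjugate_iff]
    refine ⟨?_, by simpa using hαβ⟩
    rw [lt_div_iff₀ hα]; linarith
  have hterm (γ x : ℝ) (hγ : 0 < γ) (n : ℕ) :
      ((b n * Real.exp (-(s * n * x))) ^ γ) ^ (1 / γ) = b n * Real.exp (-(s * n * x)) := by
    rw [← Real.rpow_mul (mul_nonneg (hb n) (Real.exp_nonneg _)), mul_one_div_cancel hγ.ne',
      Real.rpow_one]
  have key := Real.inner_le_Lp_mul_Lq_tsum_of_nonneg hconj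
    (f := fun n => (b n * Real.exp (-(s * n * p))) ^ α)
    (g := fun n => (b n * Real.exp (-(s * n * q))) ^ β)
    (fun n => Real.rpow_nonneg (mul_nonneg (hb n) (Real.exp_nonneg _)) _)
    (fun n => Real.rpow_nonneg (mul_nonneg (hb n) (Real.exp_nonneg _)) _)
    (by simpa only [hterm _ _ hα] using (hE p hp).summable)
    (by simpa only [hterm _ _ hβ] using (hE q hq).summable)
  simp only [hterm _ _ hα, hterm _ _ hβ, (hE p hp).tsum_eq, (hE q hq).tsum_eq, one_div_one_div]
    at key
  have hprod (n : ℕ) : (b n * Real.exp (-(s * n * p))) ^ α * (b n * Real.exp (-(s * n * q))) ^ β =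
      b n * Real.exp (-(s * n * (α * p + β * q))) := by
    rw [Real.mul_rpow (hb n) (Real.exp_nonneg _), Real.mul_rpow (hb n) (Real.exp_nonneg _),
      ← Real.exp_mul, ← Real.exp_mul, mul_mul_mul_comm, ← Real.exp_add,
      ← Real.rpow_add_of_nonneg (hb n) hα.le hβ.le, hαβ, Real.rpow_one]
    congr 2
    ring
  simp only [hprod, (hE _ hpq).tsum_eq] at key
  have h1 := Real.log_le_log (hpos _ hpq) key
  rw [Real.log_mul (Real.rpow_pos_of_pos (hpos p hp) _).ne'
    (Real.rpow_pos_of_pos (hpos q hq) _).ne',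
    Real.log_rpow (hpos p hp), Real.log_rpow (hpos q hq)] at h1
  simpa using h1

/-- The exponential is convex and increasing, and `E = exp ∘ log E`. -/
theorem ConvexOn.of_log {S : Set ℝ} {E : ℝ → ℝ} (hpos : ∀ p ∈ S, 0 < E p)
    (h : ConvexOn ℝ S fun p => Real.log (E p)) : ConvexOn ℝ S E := by
  refine ⟨h.1, fun p hp q hq α β hα hβ hαβ => ?_⟩
  have h1 := h.2 hp hq hα hβ hαβ
  have h2 := convexOn_exp.2 (mem_univ (Real.log (E p))) (mem_univ (Real.log (E q))) hα hβ hαβ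
  rw [Real.exp_log (hpos p hp), Real.exp_log (hpos q hq)] at h2
  calc E (α • p + β • q) = Real.exp (Real.log (E (α • p + β • q))) :=
        (Real.exp_log (hpos _ (h.1 hp hq hα hβ hαβ))).symm
    _ ≤ _ := (Real.exp_le_exp.2 h1).trans h2

/-! ### Holomorphic functions and primitives below a graph. -/

/-- A function of two real variables whose partial derivatives are continuous and satisfy the
Cauchy-Riemann equations is holomorphic. -/
theorem hasDerivAt_complex_of_partials {F : ℝ → ℝ → ℂ} {f : ℂ → ℂ} {U : Set ℂ} (hU : IsOpen U)
    (hx : ∀ z ∈ U, HasDerivAt (fun s => F s z.im) (f z) z.re)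
    (hy : ∀ z ∈ U, HasDerivAt (fun s => F z.re s) (Complex.I * f z) z.im)
    (hf : ContinuousOn f U) {z : ℂ} (hz : z ∈ U) :
    HasDerivAt (fun z : ℂ => F z.re z.im) (f z) z := by
  let e := Complex.equivRealProdCLM
  have hmem : ∀ᶠ p in 𝓝 (e z), e.symm p ∈ U :=
    e.symm.continuous.continuousAt.eventually (by simpa using hU.mem_nhds hz)
  have hcf : ContinuousAt (fun p : ℝ × ℝ => f (e.symm p)) (e z) := by
    refine ContinuousAt.comp (g := f) ?_ e.symm.continuous.continuousAt
    simpa using hf.continuousAt (hU.mem_nhds hz)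
  let f₁ : ℝ → ℝ → ℝ →L[ℝ] ℂ := fun x y =>
    ContinuousLinearMap.toSpanSingleton ℝ (f (e.symm (x, y)))
  let f₂ : ℝ → ℝ → ℝ →L[ℝ] ℂ := fun x y =>
    ContinuousLinearMap.toSpanSingleton ℝ (Complex.I * f (e.symm (x, y)))
  have hc1 : ContinuousAt (fun p : ℝ × ℝ => f₁ p.1 p.2) (e z) :=
    (ContinuousLinearMap.toSpanSingletonCLE (𝕜 := ℝ) (E := ℂ)).continuous.continuousAt.comp hcf
  have hc2 : ContinuousAt (fun p : ℝ × ℝ => f₂ p.1 p.2) (e z) :=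
    (ContinuousLinearMap.toSpanSingletonCLE (𝕜 := ℝ) (E := ℂ)).continuous.continuousAt.comp
      (continuousAt_const.mul hcf)
  have key := hasStrictFDerivAt_uncurry_coprod (𝕜 := ℝ) (u := e z) (f := F) (f₁ := f₁) (f₂ := f₂)
    (by
      filter_upwards [hmem] with p hp
      have := (hx _ hp).hasFDerivAt
      simpa [e, f₁, Function.HasUncurry.uncurry] using! this)
    (by
      filter_upwards [hmem] with p hp
      have := (hy _ hp).hasFDerivAt
      simpa [e, f₂, Function.HasUncurry.uncurry] using! this)
    hc1 hc2
  have h2 := key.hasFDerivAt.comp z e.hasFDerivAt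
  rw [hasDerivAt_iff_hasFDerivAt]
  -- The real derivative sends `w` to `Re w · f(z) + Im w · i f(z) = w f(z)`, so it is complex
  -- linear.
  refine hasFDerivAt_of_restrictScalars ℝ h2 (ContinuousLinearMap.ext fun w => ?_)
  have hez : Complex.equivRealProdCLM.symm (z.re, z.im) = z :=
    Complex.equivRealProdCLM.symm_apply_apply z
  simp only [e, f₁, f₂, Function.HasUncurry.uncurry, id, hez, Complex.equivRealProdCLM_apply,
    ContinuousLinearMap.coe_restrictScalars', ContinuousLinearMap.toSpanSingleton_apply,
    ContinuousLinearMap.comp_apply, ContinuousLinearEquiv.coe_coe, smul_eq_mul,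
    ContinuousLinearMap.coprod_apply, Complex.real_smul]
  nth_rewrite 1 [← Complex.re_add_im w]
  ring

section SubgraphRegion

variable {η : ℝ → ℝ}

theorem isOpen_im_lt_comp_re (hη : Continuous η) : IsOpen {z : ℂ | z.im < η z.re} :=
  isOpen_lt Complex.continuous_im (hη.comp Complex.continuous_re)

/-- A holomorphic function on the region below the graph of a continuous function that is bounded
below has a primitive. -/
theorem exists_primitive_of_differentiableOn_subgraph (hη : Continuous η) {y₀ : ℝ}
    (hy₀ : ∀ x, y₀ < η x) {f : ℂ → ℂ} (hf : DifferentiableOn ℂ f {z | z.im < η z.re}) :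
    ∃ F : ℂ → ℂ, ∀ z : ℂ, z.im < η z.re → HasDerivAt F (f z) z := by
  have hU := isOpen_im_lt_comp_re hη
  have hfc := hf.continuousOn
  have hlow (x : ℝ) : (x + y₀ * Complex.I : ℂ) ∈ {z : ℂ | z.im < η z.re} := by simpa using hy₀ x
  have hcH (y : ℝ) : ContinuousOn (fun s : ℝ => f (s + y * Complex.I)) {s | y < η s} :=
    hfc.comp (by fun_prop) fun s hs => by simpa using hs
  have hcV (x : ℝ) : ContinuousOn (fun s : ℝ => f (x + s * Complex.I)) (Iio (η x)) :=
    hfc.comp (by fun_prop) fun s hs => by simpa using hs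
  have hiV (x a b : ℝ) (ha : a < η x) (hb : b < η x) :
      IntervalIntegrable (fun s : ℝ => f (x + s * Complex.I)) MeasureTheory.volume a b :=
    ((hcV x).mono fun s hs => (hs.2.trans_lt (max_lt ha hb))).intervalIntegrable
  have hiH (a b : ℝ) :
      IntervalIntegrable (fun s : ℝ => f (s + y₀ * Complex.I)) MeasureTheory.volume a b :=
    ((hcH y₀).mono fun s _ => hy₀ s).intervalIntegrable
  -- Integration along the level `y₀`, which lies wholly below the graph, and then vertically. The
  -- `y`-derivative is immediate; the `x`-derivative follows from Cauchy's theorem on a rectangle.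
  let F : ℝ → ℝ → ℂ := fun x y => (∫ s in (0 : ℝ)..x, f (s + y₀ * Complex.I)) +
    Complex.I * ∫ s in y₀..y, f (x + s * Complex.I)
  refine ⟨fun z => F z.re z.im, fun z hz =>
    hasDerivAt_complex_of_partials hU (F := F) ?_ ?_ hfc hz⟩
  · intro z hz
    -- The rectangle between the heights `y₀` and `z.im` must stay below the graph, whichever height
    -- is larger.
    have hop : IsOpen {s : ℝ | max y₀ z.im < η s} := isOpen_lt continuous_const hη
    have hmem : z.re ∈ {s : ℝ | max y₀ z.im < η s} := max_lt (hy₀ _) hz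
    obtain ⟨ε, hε, hball⟩ := Metric.isOpen_iff.1 hop _ hmem
    have hseg {x : ℝ} (hx : x ∈ Metric.ball z.re ε) : ∀ s ∈ uIcc z.re x, max y₀ z.im < η s := by
      intro s hs
      refine hball ?_
      rw [Real.ball_eq_Ioo] at hx ⊢
      rcases le_total z.re x with h | h
      · rw [uIcc_of_le h] at hs
        exact ⟨by linarith [hs.1], by linarith [hs.2, hx.2]⟩
      · rw [uIcc_of_ge h] at hs
        exact ⟨by linarith [hs.1, hx.1], by linarith [hs.2]⟩
    have hEq : ∀ᶠ x in 𝓝 z.re,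
        F x z.im = F z.re z.im + ∫ s in z.re..x, f (s + z.im * Complex.I) := by
      filter_upwards [Metric.ball_mem_nhds z.re hε] with x hx
      have hrect := Complex.integral_boundary_rect_eq_zero_of_differentiableOn f
        (z.re + y₀ * Complex.I) (x + z.im * Complex.I) (hf.mono (by
          intro w hw
          rw [Complex.mem_reProdIm] at hw
          simp only [Complex.add_re, Complex.ofReal_re, Complex.mul_re, Complex.I_re, mul_zero,
            Complex.ofReal_im, Complex.I_im, mul_one, sub_self, add_zero, Complex.add_im,
            Complex.mul_im, zero_add] at hw
          exact hw.2.2.trans_lt (hseg hx _ hw.1)))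
      simp only [Complex.add_re, Complex.ofReal_re, Complex.mul_re, Complex.I_re, mul_zero,
            Complex.ofReal_im, Complex.I_im, mul_one, sub_self, add_zero, Complex.add_im,
            Complex.mul_im, zero_add, smul_eq_mul] at hrect
      have hsplit := intervalIntegral.integral_add_adjacent_intervals (hiH 0 z.re) (hiH z.re x)
      simp only [F]
      rw [← hsplit]
      linear_combination hrect
    refine HasDerivAt.congr_of_eventuallyEq ?_ hEq
    refine HasDerivAt.const_add _ ?_
    have hop2 : IsOpen {s : ℝ | z.im < η s} := isOpen_lt continuous_const hη
    have := intervalIntegral.integral_hasDerivAt_right (a := z.re) (b := z.re)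
      (f := fun s : ℝ => f (s + z.im * Complex.I)) (by simp)
      ((hcH z.im).stronglyMeasurableAtFilter hop2 _ hz)
      ((hcH z.im).continuousAt (hop2.mem_nhds hz))
    simpa using this
  · intro z hz
    refine (HasDerivAt.const_mul Complex.I ?_).const_add _
    have := intervalIntegral.integral_hasDerivAt_right (hiV z.re y₀ z.im (hy₀ _) hz)
      ((hcV z.re).stronglyMeasurableAtFilter isOpen_Iio _ hz)
      ((hcV z.re).continuousAt (isOpen_Iio.mem_nhds hz))
    simpa using this

end SubgraphRegion

/-! ### The complex velocity, the velocity potential and the stream function. -/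

namespace DeepWaterStokesWave

variable (W : DeepWaterStokesWave)

theorem continuous_η : Continuous W.η := W.differentiable_η.continuous

theorem isOpen_fluidDomain : IsOpen W.fluidDomain := isOpen_im_lt_comp_re W.continuous_η

theorem isOpen_belowGraph : IsOpen (belowGraph W.η) :=
  isOpen_lt continuous_snd (W.continuous_η.comp continuous_fst)

theorem isCompact_range_η : IsCompact (range W.η) :=
  Function.Periodic.compact_of_continuous W.η_periodic W.L_pos.ne' W.continuous_η

theorem exists_lt_η : ∃ y₀, ∀ x, y₀ < W.η x := by
  obtain ⟨m, hm⟩ := W.isCompact_range_η.bddBelow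
  exact ⟨m - 1, fun x => by linarith [hm (mem_range_self x)]⟩

theorem exists_η_le : ∃ M, ∀ x, W.η x ≤ M := by
  obtain ⟨M, hM⟩ := W.isCompact_range_η.bddAbove
  exact ⟨M, fun x => hM (mem_range_self x)⟩

/-- The extension of a velocity component above the free surface, constant on vertical lines. -/
def verticalExtension (w : ℝ → ℝ → ℝ) (x y : ℝ) : ℝ := w x (min y (W.η x))

theorem continuous_verticalExtension {w : ℝ → ℝ → ℝ}
    (hw : ContinuousOn (fun z : ℝ × ℝ => w z.1 z.2) (onOrBelowGraph W.η)) :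
    Continuous fun z : ℝ × ℝ => W.verticalExtension w z.1 z.2 := by
  have hη := W.continuous_η
  have : Continuous fun z : ℝ × ℝ => (z.1, min z.2 (W.η z.1)) := by fun_prop
  exact hw.comp_continuous this fun z => by simp [onOrBelowGraph]

theorem verticalExtension_of_le {w : ℝ → ℝ → ℝ} {x y : ℝ} (h : y ≤ W.η x) :
    W.verticalExtension w x y = w x y := by
  rw [verticalExtension, min_eq_left h]

/-- The horizontal velocity is bounded away from the wave speed up to the free surface. -/
theorem exists_u_le_sub : ∃ δ > 0, ∀ x y, y ≤ W.η x → W.u x y ≤ W.c - δ := by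
  obtain ⟨M, hM⟩ := W.exists_η_le
  have hc := W.c_pos
  -- At great depth `u < c/2`. Above that depth, periodicity leaves one compact rectangle; it may
  -- protrude from the water, so compactness is applied to the vertical extension of `u`.
  have h1 := (Metric.tendstoUniformly_iff.1 W.u_tendsto) (W.c / 2) (by positivity)
  obtain ⟨Y, hY⟩ := eventually_atBot.1 h1
  obtain ⟨δ, hδ, hle⟩ := (isCompact_Icc.prod isCompact_Icc :
      IsCompact (Icc 0 W.L ×ˢ Icc Y M)).exists_forall_le'
    (f := fun z : ℝ × ℝ => W.c - W.verticalExtension W.u z.1 z.2) (a := 0)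
    (continuous_const.sub (W.continuous_verticalExtension W.continuousOn_u)).continuousOn
    (fun z _ => sub_pos.2 (W.u_lt_c _ _ (min_le_right _ _)))
  refine ⟨min δ (W.c / 2), by positivity, fun x y hy => ?_⟩
  rcases le_total y Y with h | h
  · have := hY y h x
    rw [Real.dist_eq, abs_lt] at this
    linarith [min_le_right δ (W.c / 2)]
  · have hper : Function.Periodic (fun x => W.verticalExtension W.u x y) W.L := fun x => by
      simp only [verticalExtension, W.η_periodic]
      exact W.u_periodic _ _ (min_le_right _ _)
    obtain ⟨x', hx', he⟩ := hper.exists_mem_Ico₀ W.L_pos x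
    have := hle (x', y) ⟨⟨hx'.1, hx'.2.le⟩, ⟨h, hy.trans (hM x)⟩⟩
    simp only [← he, W.verticalExtension_of_le hy] at this
    linarith [min_le_left δ (W.c / 2)]

/-- The complex velocity `(u - c) - i v` in the moving frame. -/
def complexVelocity (z : ℂ) : ℂ :=
  ((W.u z.re z.im - W.c : ℝ) : ℂ) - (W.v z.re z.im : ℝ) * Complex.I

@[simp] theorem complexVelocity_re (z : ℂ) :
    (W.complexVelocity z).re = W.u z.re z.im - W.c := by simp [complexVelocity]

@[simp] theorem complexVelocity_im (z : ℂ) : (W.complexVelocity z).im = -W.v z.re z.im := by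
  simp [complexVelocity]

/-- Incompressibility and irrotationality are the Cauchy-Riemann equations for `(u - c) - iv`. -/
theorem differentiableOn_complexVelocity : DifferentiableOn ℂ W.complexVelocity W.fluidDomain := by
  intro z hz
  have hz' : z.im < W.η z.re := hz
  have hmem : (z.re, z.im) ∈ belowGraph W.η := hz
  have hnhds := W.isOpen_belowGraph.mem_nhds hmem
  have hu := (W.contDiffOn_u.differentiableOn one_ne_zero).differentiableAt hnhds
  have hv := (W.contDiffOn_v.differentiableOn one_ne_zero).differentiableAt hnhds
  let e := Complex.equivRealProdCLM
  obtain ⟨A, hA⟩ := hu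
  obtain ⟨B, hB⟩ := hv
  have hx : HasDerivAt (fun s : ℝ => (s, z.im)) (1, 0) z.re :=
    (hasDerivAt_id _).prodMk (hasDerivAt_const _ _)
  have hy : HasDerivAt (fun s : ℝ => (z.re, s)) (0, 1) z.im :=
    (hasDerivAt_const _ _).prodMk (hasDerivAt_id _)
  have hux : partialX W.u z.re z.im = A (1, 0) :=
    (HasFDerivAt.comp_hasDerivAt (l := fun z : ℝ × ℝ => W.u z.1 z.2) z.re hA hx).deriv
  have huy : partialY W.u z.re z.im = A (0, 1) :=
    (HasFDerivAt.comp_hasDerivAt (l := fun z : ℝ × ℝ => W.u z.1 z.2) z.im hA hy).deriv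
  have hvx : partialX W.v z.re z.im = B (1, 0) :=
    (HasFDerivAt.comp_hasDerivAt (l := fun z : ℝ × ℝ => W.v z.1 z.2) z.re hB hx).deriv
  have hvy : partialY W.v z.re z.im = B (0, 1) :=
    (HasFDerivAt.comp_hasDerivAt (l := fun z : ℝ × ℝ => W.v z.1 z.2) z.im hB hy).deriv
  have h1 := W.incompressible _ _ hz'
  have h2 := W.irrotational _ _ hz'
  rw [hux, hvy] at h1
  rw [huy, hvx] at h2
  have hA' : HasFDerivAt (fun w : ℂ => W.u w.re w.im) (A.comp (e : ℂ →L[ℝ] ℝ × ℝ)) z :=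
    HasFDerivAt.comp (g := fun z : ℝ × ℝ => W.u z.1 z.2) z hA e.hasFDerivAt
  have hB' : HasFDerivAt (fun w : ℂ => W.v w.re w.im) (B.comp (e : ℂ →L[ℝ] ℝ × ℝ)) z :=
    HasFDerivAt.comp (g := fun z : ℝ × ℝ => W.v z.1 z.2) z hB e.hasFDerivAt
  have hf := ((Complex.ofRealCLM.hasFDerivAt).comp z (hA'.sub_const W.c)).sub
    (((Complex.ofRealCLM.hasFDerivAt).comp z hB').mul_const Complex.I)
  refine (DifferentiableAt.differentiableWithinAt ?_)
  refine (hf.complexOfReal_hasFDerivAt ?_).differentiableAt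
  have e1 : e Complex.I = (0, 1) := by simp [e]
  have e2 : e 1 = (1, 0) := by simp [e]
  simp [e1, e2]
  apply Complex.ext
  · simp; linarith
  · simp; linarith

theorem continuousOn_complexVelocity : ContinuousOn W.complexVelocity W.fluidDomain :=
  W.differentiableOn_complexVelocity.continuousOn

theorem exists_complex_potential :
    ∃ F : ℂ → ℂ, ∀ z ∈ W.fluidDomain, HasDerivAt F (W.complexVelocity z) z :=
  have ⟨_, hy₀⟩ := W.exists_lt_η
  exists_primitive_of_differentiableOn_subgraph W.continuous_η hy₀
    W.differentiableOn_complexVelocity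

theorem exists_isVelocityPotential : ∃ φ : ℝ → ℝ → ℝ, W.IsVelocityPotential φ := by
  obtain ⟨F, hF⟩ := W.exists_complex_potential
  refine ⟨fun x y => (F (x + y * Complex.I)).re, fun x y h => ?_, fun x y h => ?_⟩
  · have h1 := hF (x + y * Complex.I) (by simpa [fluidDomain] using h)
    have h2 : HasDerivAt (fun s : ℝ => (s + y * Complex.I : ℂ)) 1 x :=
      Complex.ofRealCLM.hasDerivAt.add_const _
    have := Complex.reCLM.hasFDerivAt.comp_hasDerivAt x (h1.comp x h2)
    simpa [Function.comp_def] using this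
  · have h1 := hF (x + y * Complex.I) (by simpa [fluidDomain] using h)
    have h2 : HasDerivAt (fun s : ℝ => (x + s * Complex.I : ℂ)) (1 * Complex.I) y :=
      (Complex.ofRealCLM.hasDerivAt.mul_const _).const_add _
    have := Complex.reCLM.hasFDerivAt.comp_hasDerivAt y (h1.comp y h2)
    simpa [Function.comp_def] using this

/-- The kinematic condition can be solved for the slope because `u < c` on the surface; this
upgrades `η` from differentiable to `C¹`. -/
theorem deriv_η_eq (x : ℝ) :
    deriv W.η x = W.verticalExtension W.v x (W.η x) /
      (W.verticalExtension W.u x (W.η x) - W.c) := by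
  have h := W.u_lt_c x (W.η x) le_rfl
  rw [W.verticalExtension_of_le le_rfl, W.verticalExtension_of_le le_rfl, W.kinematic,
    mul_div_cancel_left₀]
  linarith

theorem continuous_deriv_η : Continuous (deriv W.η) := by
  have hη := W.continuous_η
  have hu := W.continuous_verticalExtension W.continuousOn_u
  have hv := W.continuous_verticalExtension W.continuousOn_v
  have hc : Continuous fun x => (x, W.η x) := by fun_prop
  rw [funext W.deriv_η_eq]
  refine (hv.comp hc).div ((hu.comp hc).sub continuous_const) fun x => ?_
  have h := W.u_lt_c x (min (W.η x) (W.η x)) (min_le_right _ _)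
  exact (sub_neg.2 h).ne

/-- A function with the derivatives of the stream function in the fluid takes almost the same
values at two points just below the surface. -/
theorem tendsto_sub_near_surface {F : ℂ → ℂ}
    (hF : ∀ z ∈ W.fluidDomain, HasDerivAt F (W.complexVelocity z) z) (a b : ℝ) :
    Tendsto (fun ε : ℝ => (F (b + (W.η b - ε : ℝ) * Complex.I)).im -
      (F (a + (W.η a - ε : ℝ) * Complex.I)).im) (𝓝[>] 0) (𝓝 0) := by
  have hη := W.continuous_η
  have hη' := W.continuous_deriv_η
  have hu := W.continuous_verticalExtension W.continuousOn_u
  have hv := W.continuous_verticalExtension W.continuousOn_v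
  -- The derivative of `Im F` along the surface lowered by `ε`. At `ε = 0` it vanishes by the
  -- kinematic condition: the surface is a streamline.
  let K : ℝ → ℝ → ℝ := fun ε x => -W.verticalExtension W.v x (W.η x - ε) +
    (W.verticalExtension W.u x (W.η x - ε) - W.c) * deriv W.η x
  have hmap : Continuous fun p : ℝ × ℝ => (p.2, W.η p.2 - p.1) := by fun_prop
  have hK : Continuous (Function.uncurry K) :=
    (hv.comp hmap).neg.add (((hu.comp hmap).sub continuous_const).mul (hη'.comp continuous_snd))
  have hlim : Tendsto (fun ε => ∫ x in a..b, K ε x) (𝓝[>] 0) (𝓝 0) := by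
    have h1 := (intervalIntegral.continuous_parametric_intervalIntegral_of_continuous'
      (μ := MeasureTheory.volume) hK a b).tendsto 0
    have h0 : ∀ x, K 0 x = 0 := fun x => by
      simp only [K, sub_zero, W.verticalExtension_of_le le_rfl]
      linarith [W.kinematic x]
    simp only [h0, intervalIntegral.integral_zero] at h1
    exact h1.mono_left nhdsWithin_le_nhds
  refine hlim.congr' ?_
  filter_upwards [self_mem_nhdsWithin] with ε hε
  have hε : 0 < ε := hε
  refine intervalIntegral.integral_eq_sub_of_hasDerivAt
    (f := fun x : ℝ => (F (x + (W.η x - ε : ℝ) * Complex.I)).im) (fun x _ => ?_)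
    ((hK.comp (by fun_prop : Continuous fun x : ℝ => (ε, x))).intervalIntegrable _ _)
  have h1 := hF (x + (W.η x - ε : ℝ) * Complex.I) (by simpa [fluidDomain] using hε)
  have h2 : HasDerivAt (fun s : ℝ => (s + (W.η s - ε : ℝ) * Complex.I : ℂ))
      (1 + (deriv W.η x : ℝ) * Complex.I) x :=
    Complex.ofRealCLM.hasDerivAt.add
      ((((W.differentiable_η x).hasDerivAt.sub_const ε).ofReal_comp).mul_const _)
  have h3 := Complex.imCLM.hasFDerivAt.comp_hasDerivAt x (h1.comp x h2)
  convert! h3 using 1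
  have hle : W.η x - ε ≤ W.η x := by linarith
  simp [K, W.verticalExtension_of_le hle]
  ring

/-- Integrating `u - c` vertically from the surface yields `ψ_y`, continuity and the boundary value
at once. For `ψ_x`, the difference `ψ - Im F` is constant on each vertical, and the constants of two
verticals agree by comparison just below the surface. -/
theorem exists_isStreamFunction : ∃ ψ : ℝ → ℝ → ℝ, W.IsStreamFunction ψ := by
  obtain ⟨F, hF⟩ := W.exists_complex_potential
  have hη := W.continuous_η
  have hu := W.continuous_verticalExtension W.continuousOn_u
  let ψ : ℝ → ℝ → ℝ := fun x y =>
    ∫ s in (W.η x)..y, (W.verticalExtension W.u x s - W.c)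
  have hcx (x : ℝ) : Continuous fun s => W.verticalExtension W.u x s - W.c :=
    (hu.comp (by fun_prop : Continuous fun s : ℝ => (x, s))).sub continuous_const
  have hψc : Continuous fun z : ℝ × ℝ => ψ z.1 z.2 := by
    have hg : Continuous (Function.uncurry fun (z : ℝ × ℝ) (s : ℝ) =>
        W.verticalExtension W.u z.1 s - W.c) :=
      (hu.comp (by fun_prop : Continuous fun q : (ℝ × ℝ) × ℝ => (q.1.1, q.2))).sub
        continuous_const
    have h1 := intervalIntegral.continuous_parametric_intervalIntegral_of_continuous
      (μ := MeasureTheory.volume) (a₀ := 0) hg continuous_snd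
    have h2 := intervalIntegral.continuous_parametric_intervalIntegral_of_continuous
      (μ := MeasureTheory.volume) (a₀ := 0) hg (hη.comp continuous_fst)
    refine (h1.sub h2).congr fun z => ?_
    exact intervalIntegral.integral_interval_sub_left ((hcx z.1).intervalIntegrable _ _)
      ((hcx z.1).intervalIntegrable _ _)
  have hψy (x y : ℝ) (h : y < W.η x) : HasDerivAt (fun s => ψ x s) (W.u x y - W.c) y := by
    have := (hcx x).integral_hasStrictDerivAt (W.η x) y
    simpa [W.verticalExtension_of_le h.le] using this.hasDerivAt
  have hFy (x y : ℝ) (h : y < W.η x) :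
      HasDerivAt (fun s : ℝ => (F (x + s * Complex.I)).im) (W.u x y - W.c) y := by
    have h1 := hF (x + y * Complex.I) (by simpa [fluidDomain] using h)
    have h2 : HasDerivAt (fun s : ℝ => (x + s * Complex.I : ℂ)) (1 * Complex.I) y :=
      (Complex.ofRealCLM.hasDerivAt.mul_const _).const_add _
    have := Complex.imCLM.hasFDerivAt.comp_hasDerivAt y (h1.comp y h2)
    simpa [Function.comp_def] using this
  have hFx (x y : ℝ) (h : y < W.η x) :
      HasDerivAt (fun s : ℝ => (F (s + y * Complex.I)).im) (-W.v x y) x := by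
    have h1 := hF (x + y * Complex.I) (by simpa [fluidDomain] using h)
    have h2 : HasDerivAt (fun s : ℝ => (s + y * Complex.I : ℂ)) 1 x :=
      Complex.ofRealCLM.hasDerivAt.add_const _
    have := Complex.imCLM.hasFDerivAt.comp_hasDerivAt x (h1.comp x h2)
    simpa [Function.comp_def] using this
  have hvert (x y y' : ℝ) (h : y < W.η x) (h' : y' < W.η x) :
      ψ x y - (F (x + y * Complex.I)).im = ψ x y' - (F (x + y' * Complex.I)).im := by
    refine (convex_Iio (W.η x)).is_const_of_fderivWithin_eq_zero (𝕜 := ℝ)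
      (f := fun s : ℝ => ψ x s - (F (x + s * Complex.I)).im) (fun s hs => ?_) (fun s hs => ?_) h h'
    · exact ((hψy x s hs).sub (hFy x s hs)).differentiableAt.differentiableWithinAt
    · have := ((hψy x s hs).sub (hFy x s hs)).hasFDerivAt
      rw [fderivWithin_of_isOpen isOpen_Iio hs]
      simpa using! this.fderiv
  have hconst (a b ya yb : ℝ) (ha : ya < W.η a) (hb : yb < W.η b) :
      ψ a ya - (F (a + ya * Complex.I)).im = ψ b yb - (F (b + yb * Complex.I)).im := by
    have hlim (x : ℝ) : Tendsto (fun ε : ℝ => ψ x (W.η x - ε)) (𝓝[>] 0) (𝓝 0) := by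
      have h1 : Tendsto (fun ε : ℝ => ψ x (W.η x - ε)) (𝓝 0) (𝓝 (ψ x (W.η x - 0))) :=
        (hψc.comp (by fun_prop : Continuous fun ε : ℝ => (x, W.η x - ε))).tendsto 0
      simp only [ψ, sub_zero, intervalIntegral.integral_same] at h1
      exact h1.mono_left nhdsWithin_le_nhds
    have h2 := ((hlim b).sub (hlim a)).sub (W.tendsto_sub_near_surface hF a b)
    simp only [sub_zero] at h2
    have h3 := tendsto_nhds_unique (h2.congr' (f₂ := fun _ =>
        (ψ b yb - (F (b + yb * Complex.I)).im) - (ψ a ya - (F (a + ya * Complex.I)).im)) (by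
      filter_upwards [self_mem_nhdsWithin] with ε hε
      have hε : 0 < ε := hε
      rw [hvert b yb (W.η b - ε) hb (by linarith), hvert a ya (W.η a - ε) ha (by linarith)]
      ring)) tendsto_const_nhds
    linarith
  refine ⟨ψ, fun x y h => ?_, hψy, hψc.continuousOn, fun x => by simp [ψ]⟩
  refine ((hFx x y h).add_const (ψ x y - (F (x + y * Complex.I)).im)).congr_of_eventuallyEq ?_
  have hop : IsOpen {s : ℝ | y < W.η s} := isOpen_lt continuous_const hη
  filter_upwards [hop.mem_nhds h] with s hs
  linarith [hconst s x y y hs h]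

end DeepWaterStokesWave

/-! ### Streamlines and bijectivity of the hodograph transform. -/

namespace DeepWaterStokesWave

variable {W : DeepWaterStokesWave} {ψ φ : ℝ → ℝ → ℝ}

theorem complexVelocity_ne_zero {z : ℂ} (hz : z ∈ W.fluidDomain) : W.complexVelocity z ≠ 0 := by
  intro h
  have h1 := W.u_lt_c z.re z.im (le_of_lt hz)
  have h2 := congrArg Complex.re h
  rw [complexVelocity_re, Complex.zero_re] at h2
  linarith

theorem hasDerivAt_hodograph (hψ : W.IsStreamFunction ψ) (hφ : W.IsVelocityPotential φ) {z : ℂ}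
    (hz : z ∈ W.fluidDomain) : HasDerivAt (hodograph φ ψ) (W.complexVelocity z) z := by
  refine hasDerivAt_complex_of_partials W.isOpen_fluidDomain
    (F := fun x y => (φ x y : ℂ) + (ψ x y : ℂ) * Complex.I) (fun z hz => ?_) (fun z hz => ?_)
    W.continuousOn_complexVelocity hz
  · convert! ((hφ.hasDerivAt_x _ _ hz).ofReal_comp).add
      (((hψ.hasDerivAt_x _ _ hz).ofReal_comp).mul_const Complex.I) using 1
    simp [complexVelocity]
    ring
  · convert! ((hφ.hasDerivAt_y _ _ hz).ofReal_comp).add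
      (((hψ.hasDerivAt_y _ _ hz).ofReal_comp).mul_const Complex.I) using 1
    simp only [complexVelocity]
    linear_combination (-(W.v z.re z.im : ℂ)) * Complex.I_sq

theorem IsStreamFunction.continuousOn_vertical (hψ : W.IsStreamFunction ψ) (x : ℝ) :
    ContinuousOn (ψ x) (Iic (W.η x)) :=
  hψ.continuousOn.comp (f := fun s : ℝ => (x, s)) (by fun_prop) fun s hs => hs

theorem IsStreamFunction.strictAntiOn (hψ : W.IsStreamFunction ψ) (x : ℝ) :
    StrictAntiOn (ψ x) (Iic (W.η x)) := by
  refine strictAntiOn_of_deriv_neg (convex_Iic _) (hψ.continuousOn_vertical x) fun y hy => ?_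
  rw [interior_Iic] at hy
  rw [(hψ.hasDerivAt_y x y hy).deriv]
  linarith [W.u_lt_c x y (le_of_lt hy)]

theorem IsStreamFunction.pos (hψ : W.IsStreamFunction ψ) {x y : ℝ} (h : y < W.η x) :
    0 < ψ x y := by
  rw [← hψ.surface x]
  exact hψ.strictAntiOn x (le_of_lt h) self_mem_Iic h

theorem IsStreamFunction.eq_of_eq (hψ : W.IsStreamFunction ψ) {x y y' : ℝ} (h : y < W.η x)
    (h' : y' < W.η x) (he : ψ x y = ψ x y') : y = y' :=
  (hψ.strictAntiOn x).injOn (le_of_lt h) (le_of_lt h') he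

theorem IsStreamFunction.existsUnique_streamline (hψ : W.IsStreamFunction ψ) {p : ℝ} (hp : 0 < p)
    (x : ℝ) : ∃! y, y < W.η x ∧ ψ x y = p := by
  obtain ⟨δ, hδ, hle⟩ := W.exists_u_le_sub
  refine existsUnique_of_exists_of_unique ?_ fun y y' h h' =>
    hψ.eq_of_eq h.1 h'.1 (h.2.trans h'.2.symm)
  -- Since `ψ_y ≤ -δ`, descending by `p / δ` from the surface raises `ψ` from `0` to at least `p`.
  have h1 : p ≤ ψ x (W.η x - p / δ) := by
    have := (convex_Iic (W.η x)).image_sub_le_mul_sub_of_deriv_le (hψ.continuousOn_vertical x)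
      (C := -δ) (fun y hy => ?_) (fun y hy => ?_) (W.η x - p / δ)
      (by rw [mem_Iic]; linarith [div_pos hp hδ]) (W.η x) self_mem_Iic
      (by linarith [div_pos hp hδ])
    · rw [hψ.surface, sub_sub_cancel, neg_mul, mul_div_cancel₀ _ hδ.ne'] at this
      linarith
    · rw [interior_Iic] at hy
      exact (hψ.hasDerivAt_y x y hy).differentiableAt.differentiableWithinAt
    · rw [interior_Iic] at hy
      rw [(hψ.hasDerivAt_y x y hy).deriv]
      linarith [hle x y (le_of_lt hy)]
  have h2 : W.η x - p / δ ≤ W.η x := by linarith [div_pos hp hδ]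
  obtain ⟨y, hy, hye⟩ := intermediate_value_Icc' h2
    ((hψ.continuousOn_vertical x).mono Icc_subset_Iic_self) ⟨(hψ.surface x).le.trans hp.le, h1⟩
  refine ⟨y, lt_of_le_of_ne hy.2 ?_, hye⟩
  rintro rfl
  rw [hψ.surface] at hye
  exact hp.ne hye

theorem continuousAt_u {z : ℝ × ℝ} (hz : z ∈ belowGraph W.η) :
    ContinuousAt (fun z : ℝ × ℝ => W.u z.1 z.2) z :=
  W.contDiffOn_u.continuousOn.continuousAt (W.isOpen_belowGraph.mem_nhds hz)

theorem continuousAt_v {z : ℝ × ℝ} (hz : z ∈ belowGraph W.η) :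
    ContinuousAt (fun z : ℝ × ℝ => W.v z.1 z.2) z :=
  W.contDiffOn_v.continuousOn.continuousAt (W.isOpen_belowGraph.mem_nhds hz)

/-- A graph contained in a streamline is differentiable. -/
theorem IsStreamFunction.differentiable_streamline (hψ : W.IsStreamFunction ψ) {p : ℝ}
    {ξ : ℝ → ℝ} (hξ : ∀ x, ξ x < W.η x) (hp : ∀ x, ψ x (ξ x) = p) : Differentiable ℝ ξ := by
  intro x
  have hmem : (x, ξ x) ∈ belowGraph W.η := hξ x
  have hev := W.isOpen_belowGraph.eventually_mem hmem
  let f₁ : ℝ → ℝ → ℝ →L[ℝ] ℝ := fun x y => ContinuousLinearMap.toSpanSingleton ℝ (-W.v x y)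
  let f₂ : ℝ → ℝ → ℝ →L[ℝ] ℝ := fun x y => ContinuousLinearMap.toSpanSingleton ℝ (W.u x y - W.c)
  have key := hasStrictFDerivAt_uncurry_coprod (𝕜 := ℝ) (u := (x, ξ x)) (f := ψ) (f₁ := f₁)
    (f₂ := f₂)
    (by filter_upwards [hev] with q hq using (hψ.hasDerivAt_x _ _ hq).hasFDerivAt)
    (by filter_upwards [hev] with q hq using (hψ.hasDerivAt_y _ _ hq).hasFDerivAt)
    ((ContinuousLinearMap.toSpanSingletonCLE (𝕜 := ℝ) (E := ℝ)).continuous.continuousAt.comp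
      (continuousAt_v hmem).neg)
    ((ContinuousLinearMap.toSpanSingletonCLE (𝕜 := ℝ) (E := ℝ)).continuous.continuousAt.comp
      ((continuousAt_u hmem).sub continuousAt_const))
  -- The implicit function theorem applies since `ψ_y ≠ 0`. Its local solution agrees with `ξ`
  -- because `ψ` is injective on verticals.
  have hne : W.u x (ξ x) - W.c ≠ 0 := (sub_neg.2 (W.u_lt_c _ _ (hξ x).le)).ne
  have hinv : (((Function.HasUncurry.uncurry f₁ (x, ξ x)).coprod
      (Function.HasUncurry.uncurry f₂ (x, ξ x))) ∘L
        ContinuousLinearMap.inr ℝ ℝ ℝ).IsInvertible := by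
    refine ⟨ContinuousLinearEquiv.smulLeft (Units.mk0 _ hne), ?_⟩
    ext
    simp [f₂, Function.HasUncurry.uncurry]
  have hloc := key.eventually_apply_implicitFunctionOfProdDomain hinv
  have htend := key.tendsto_implicitFunctionOfProdDomain hinv
  have hd := (key.hasStrictFDerivAt_implicitFunctionOfProdDomain hinv).hasFDerivAt.differentiableAt
  refine hd.congr_of_eventuallyEq ?_
  have hbelow := (tendsto_id.prodMk_nhds htend).eventually hev
  filter_upwards [hloc, hbelow] with s hs hs'
  exact hψ.eq_of_eq (hξ s) hs' ((hp s).trans ((hp x).symm.trans hs.symm))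

/-- Along a streamline the velocity potential decreases at least at a fixed positive rate. -/
theorem hasDerivAt_potential_streamline (hψ : W.IsStreamFunction ψ) (hφ : W.IsVelocityPotential φ)
    {p : ℝ} {ξ : ℝ → ℝ} (hξ : ∀ x, ξ x < W.η x) (hp : ∀ x, ψ x (ξ x) = p) (x : ℝ) :
    ∃ d ≤ W.u x (ξ x) - W.c, HasDerivAt (fun s => φ s (ξ s)) d x := by
  have hd := (hψ.differentiable_streamline hξ hp x).hasDerivAt
  have hmem : (x + ξ x * Complex.I : ℂ) ∈ W.fluidDomain := by simpa [fluidDomain] using hξ x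
  have h1 := hasDerivAt_hodograph hψ hφ hmem
  have h2 : HasDerivAt (fun s : ℝ => (s + ξ s * Complex.I : ℂ))
      (1 + (deriv ξ x : ℝ) * Complex.I) x :=
    Complex.ofRealCLM.hasDerivAt.add ((hd.ofReal_comp).mul_const _)
  have h3 := h1.comp x h2
  have hre := Complex.reCLM.hasFDerivAt.comp_hasDerivAt x h3
  have him := Complex.imCLM.hasFDerivAt.comp_hasDerivAt x h3
  have h0 : HasDerivAt (fun s => ψ s (ξ s)) 0 x := by
    simpa only [hp] using hasDerivAt_const x p
  have him' : (W.u x (ξ x) - W.c) * deriv ξ x - W.v x (ξ x) = 0 := by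
    refine HasDerivAt.unique ?_ h0
    convert! him using 1
    · funext s; simp [hodograph]
    · simp [complexVelocity]; ring
  refine ⟨(W.u x (ξ x) - W.c) + W.v x (ξ x) * deriv ξ x, ?_, ?_⟩
  · have hneg := W.u_lt_c x (ξ x) (hξ x).le
    -- Constancy of `ψ` gives `v = (u - c) ξ'`, so the contribution of `φ_y` is nonpositive.
    have : W.v x (ξ x) * deriv ξ x = (W.u x (ξ x) - W.c) * deriv ξ x ^ 2 := by
      linear_combination (-deriv ξ x) * him'
    rw [this]
    nlinarith [sq_nonneg (deriv ξ x)]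
  · convert! hre using 1
    · funext s; simp [hodograph]
    · simp [complexVelocity]

/-- The streamlines foliate the fluid as the horizontal lines foliate the half plane, and on each
streamline `φ` has slope at most `-δ` in `x`, hence is a bijection onto the real line. -/
theorem bijOn_hodograph (hψ : W.IsStreamFunction ψ) (hφ : W.IsVelocityPotential φ) :
    BijOn (hodograph φ ψ) W.fluidDomain upperHalf := by
  obtain ⟨δ, hδ, hle⟩ := W.exists_u_le_sub
  have hstream (p : ℝ) (hp : 0 < p) : ∃ ξ : ℝ → ℝ, (∀ x, ξ x < W.η x) ∧ (∀ x, ψ x (ξ x) = p) ∧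
      StrictAnti (fun x => φ x (ξ x)) ∧ Function.Surjective (fun x => φ x (ξ x)) := by
    choose ξ hξ hξp using fun x => (hψ.existsUnique_streamline hp x).exists
    choose d hd hder using fun x => hasDerivAt_potential_streamline hψ hφ hξ hξp x
    have hdδ (x : ℝ) : d x ≤ -δ := by linarith [hd x, hle x (ξ x) (hξ x).le]
    have hdiff : Differentiable ℝ fun x => φ x (ξ x) := fun x => (hder x).differentiableAt
    have hmv (x y : ℝ) (hxy : x ≤ y) : φ y (ξ y) - φ x (ξ x) ≤ -δ * (y - x) :=
      image_sub_le_mul_sub_of_deriv_le hdiff (fun x => by rw [(hder x).deriv]; exact hdδ x) hxy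
    refine ⟨ξ, hξ, hξp, fun x y hxy => ?_, ?_⟩
    · have := mul_pos hδ (sub_pos.2 hxy)
      have := hmv x y hxy.le
      simp only
      linarith
    · refine hdiff.continuous.surjective' ?_ ?_
      · refine tendsto_atTop_mono' _ (f₁ := fun x => φ 0 (ξ 0) + -δ * x) ?_ ?_
        · filter_upwards [eventually_le_atBot 0] with x hx
          linarith [hmv x 0 hx]
        · exact tendsto_atTop_add_const_left _ _
            (tendsto_id.const_mul_atBot_of_neg (neg_neg_of_pos hδ))
      · refine tendsto_atBot_mono' _ (f₁ := fun x => φ 0 (ξ 0) + -δ * x) ?_ ?_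
        · filter_upwards [eventually_ge_atTop 0] with x hx
          linarith [hmv 0 x hx]
        · exact tendsto_atBot_add_const_left _ _
            (tendsto_id.const_mul_atTop_of_neg (neg_neg_of_pos hδ))
  refine ⟨fun z hz => ?_, fun z hz w hw he => ?_, fun w hw => ?_⟩
  · simpa [upperHalf, hodograph] using hψ.pos hz
  · have hre : φ z.re z.im = φ w.re w.im := by simpa [hodograph] using congrArg Complex.re he
    have him : ψ z.re z.im = ψ w.re w.im := by simpa [hodograph] using congrArg Complex.im he
    obtain ⟨ξ, hξ, hξp, hanti, -⟩ := hstream _ (hψ.pos hz)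
    have hz' := hψ.eq_of_eq hz (hξ z.re) (hξp z.re).symm
    have hw' := hψ.eq_of_eq hw (hξ w.re) (him.symm.trans (hξp w.re).symm)
    rw [hz', hw'] at hre
    have hre' := hanti.injective hre
    exact Complex.ext hre' (by rw [hz', hw', hre'])
  · obtain ⟨ξ, hξ, hξp, -, hsurj⟩ := hstream w.im hw
    obtain ⟨x, hx⟩ := hsurj w.re
    refine ⟨x + ξ x * Complex.I, by simpa [fluidDomain] using hξ x, ?_⟩
    apply Complex.ext
    · simpa [hodograph] using hx
    · simpa [hodograph] using hξp x

end DeepWaterStokesWave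

/-! ### Change of time along a streamline. -/

/-- A positive continuous density, bounded away from zero, has a primitive `τ` that is a bijection
of the line, and the inverse `σ` of `τ` solves `σ' = 1 / G(σ)`. -/
theorem exists_timeChange {G : ℝ → ℝ} (hG : Continuous G) {m : ℝ} (hm : 0 < m)
    (hmG : ∀ q, m ≤ G q) :
    ∃ τ σ : ℝ → ℝ, (∀ q, τ q = ∫ s in (0 : ℝ)..q, G s) ∧ (∀ q, HasDerivAt τ (G q) q) ∧
      (∀ t, HasDerivAt σ (G (σ t))⁻¹ t) ∧ (∀ q, σ (τ q) = q) ∧ ∀ t, τ (σ t) = t := by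
  let τ : ℝ → ℝ := fun q => ∫ s in (0 : ℝ)..q, G s
  have hτ (q : ℝ) : HasDerivAt τ (G q) q := (hG.integral_hasStrictDerivAt 0 q).hasDerivAt
  have hdiff : Differentiable ℝ τ := fun q => (hτ q).differentiableAt
  have hmv (x y : ℝ) (hxy : x ≤ y) : m * (y - x) ≤ τ y - τ x :=
    mul_sub_le_image_sub_of_le_deriv hdiff (fun x => by rw [(hτ x).deriv]; exact hmG x) hxy
  have hmono : StrictMono τ := fun x y hxy => by
    have := mul_pos hm (sub_pos.2 hxy)
    linarith [hmv x y hxy.le]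
  have hτ0 : τ 0 = 0 := by simp [τ]
  have hsurj : Function.Surjective τ := by
    refine hdiff.continuous.surjective ?_ ?_
    · refine tendsto_atTop_mono' _ (f₁ := fun q => m * q) ?_ (tendsto_id.const_mul_atTop hm)
      filter_upwards [eventually_ge_atTop 0] with q hq
      linarith [hmv 0 q hq]
    · refine tendsto_atBot_mono' _ (f₁ := fun q => m * q) ?_ (tendsto_id.const_mul_atBot hm)
      filter_upwards [eventually_le_atBot 0] with q hq
      linarith [hmv q 0 hq]
  let e : ℝ ≃o ℝ := hmono.orderIsoOfSurjective τ hsurj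
  have hl (q : ℝ) : e.symm (τ q) = q := e.symm_apply_apply q
  have hr (t : ℝ) : τ (e.symm t) = t := e.apply_symm_apply t
  refine ⟨τ, e.symm, fun q => rfl, hτ, fun t => ?_, hl, hr⟩
  exact (hτ _).of_local_left_inverse e.symm.continuous.continuousAt
    (hm.trans_le (hmG _)).ne' (.of_forall hr)

/-! ### The inverse hodograph transform and its periodicity. -/

namespace DeepWaterStokesWave

variable {W : DeepWaterStokesWave} {ψ φ : ℝ → ℝ → ℝ}

/-- The inverse of the hodograph transform. -/
def inverseHodograph (W : DeepWaterStokesWave) (φ ψ : ℝ → ℝ → ℝ) : ℂ → ℂ :=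
  Function.invFunOn (hodograph φ ψ) W.fluidDomain

theorem isOpen_upperHalf : IsOpen upperHalf := isOpen_lt continuous_const Complex.continuous_im

theorem inverseHodograph_mem (hψ : W.IsStreamFunction ψ) (hφ : W.IsVelocityPotential φ) {w : ℂ}
    (hw : w ∈ upperHalf) : W.inverseHodograph φ ψ w ∈ W.fluidDomain :=
  Function.invFunOn_mem ((bijOn_hodograph hψ hφ).surjOn hw)

theorem hodograph_inverseHodograph (hψ : W.IsStreamFunction ψ) (hφ : W.IsVelocityPotential φ)
    {w : ℂ} (hw : w ∈ upperHalf) : hodograph φ ψ (W.inverseHodograph φ ψ w) = w :=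
  Function.invFunOn_eq ((bijOn_hodograph hψ hφ).surjOn hw)

theorem inverseHodograph_hodograph (hψ : W.IsStreamFunction ψ) (hφ : W.IsVelocityPotential φ)
    {z : ℂ} (hz : z ∈ W.fluidDomain) : W.inverseHodograph φ ψ (hodograph φ ψ z) = z :=
  (bijOn_hodograph hψ hφ).injOn.leftInvOn_invFunOn hz

theorem hasStrictDerivAt_hodograph (hψ : W.IsStreamFunction ψ) (hφ : W.IsVelocityPotential φ)
    {z : ℂ} (hz : z ∈ W.fluidDomain) :
    HasStrictDerivAt (hodograph φ ψ) (W.complexVelocity z) z := by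
  have hd : DifferentiableOn ℂ (hodograph φ ψ) W.fluidDomain := fun z hz =>
    (hasDerivAt_hodograph hψ hφ hz).differentiableAt.differentiableWithinAt
  have := (hd.analyticAt (W.isOpen_fluidDomain.mem_nhds hz)).hasStrictDerivAt
  rwa [(hasDerivAt_hodograph hψ hφ hz).deriv] at this

theorem hasDerivAt_inverseHodograph (hψ : W.IsStreamFunction ψ) (hφ : W.IsVelocityPotential φ)
    {w : ℂ} (hw : w ∈ upperHalf) :
    HasDerivAt (W.inverseHodograph φ ψ) (W.complexVelocity (W.inverseHodograph φ ψ w))⁻¹ w := by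
  have hz := inverseHodograph_mem hψ hφ hw
  have hstrict := hasStrictDerivAt_hodograph hψ hφ hz
  have hcont : ContinuousAt (W.inverseHodograph φ ψ) w := by
    -- A nonzero derivative makes `h` locally open, which gives continuity of the inverse.
    have hmap := hstrict.map_nhds_eq (complexVelocity_ne_zero hz)
    rw [hodograph_inverseHodograph hψ hφ hw] at hmap
    rw [ContinuousAt, ← hmap, tendsto_map'_iff]
    refine tendsto_id.congr' ?_
    filter_upwards [W.isOpen_fluidDomain.mem_nhds hz] with z hz
    exact (inverseHodograph_hodograph hψ hφ hz).symm
  refine hstrict.hasDerivAt.of_local_left_inverse hcont (complexVelocity_ne_zero hz) ?_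
  filter_upwards [isOpen_upperHalf.mem_nhds hw] with w hw
  exact hodograph_inverseHodograph hψ hφ hw

theorem lt_η_add_L {x y : ℝ} (h : y < W.η x) : y < W.η (x + W.L) := by rwa [W.η_periodic]

/-- The difference of the two sides has zero `y`-derivative and vanishes on the surface. -/
theorem IsStreamFunction.add_L (hψ : W.IsStreamFunction ψ) {x y : ℝ} (h : y < W.η x) :
    ψ (x + W.L) y = ψ x y := by
  have hc : ContinuousOn (fun s => ψ (x + W.L) s - ψ x s) (Icc y (W.η x)) := by
    refine ContinuousOn.sub ?_ ((hψ.continuousOn_vertical x).mono Icc_subset_Iic_self)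
    have := hψ.continuousOn_vertical (x + W.L)
    rw [W.η_periodic] at this
    exact this.mono Icc_subset_Iic_self
  have := constant_of_has_deriv_right_zero hc (fun s hs => by
    have := (hψ.hasDerivAt_y _ s (lt_η_add_L hs.2)).sub (hψ.hasDerivAt_y x s hs.2)
    rw [W.u_periodic _ _ hs.2.le, sub_self] at this
    exact this.hasDerivWithinAt) (W.η x) ⟨h.le, le_rfl⟩
  have h0 : ψ (x + W.L) (W.η x) = 0 := by rw [← W.η_periodic, hψ.surface]
  rw [h0, hψ.surface] at this
  linarith

/-- The increment over a wavelength does not depend on depth, and at great depth `φ_x = u - c` is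
uniformly close to `-c`. -/
theorem IsVelocityPotential.add_L (hφ : W.IsVelocityPotential φ) {x y : ℝ} (h : y < W.η x) :
    φ (x + W.L) y = φ x y - W.c * W.L := by
  have hL := W.L_pos
  obtain ⟨y₀, hy₀⟩ := W.exists_lt_η
  have hconst (y' : ℝ) (h' : y' < W.η x) :
      φ (x + W.L) y - φ x y = φ (x + W.L) y' - φ x y' := by
    have hd (s : ℝ) (hs : s < W.η x) : HasDerivAt (fun s => φ (x + W.L) s - φ x s) 0 s := by
      have := (hφ.hasDerivAt_y _ s (lt_η_add_L hs)).sub (hφ.hasDerivAt_y x s hs)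
      rwa [W.v_periodic _ _ hs.le, sub_self] at this
    refine (convex_Iio (W.η x)).is_const_of_fderivWithin_eq_zero (𝕜 := ℝ)
      (f := fun s : ℝ => φ (x + W.L) s - φ x s) (fun s hs => ?_) (fun s hs => ?_) h h'
    · exact (hd s hs).differentiableAt.differentiableWithinAt
    · rw [fderivWithin_of_isOpen isOpen_Iio hs]
      simpa using! (hd s hs).hasFDerivAt.fderiv
  have hsmall (ε : ℝ) (hε : 0 < ε) : |φ (x + W.L) y - φ x y + W.c * W.L| ≤ ε := by
    obtain ⟨Y, hY⟩ := eventually_atBot.1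
      ((Metric.tendstoUniformly_iff.1 W.u_tendsto) (ε / W.L) (by positivity))
    have hm : ∀ s, min Y y₀ < W.η s := fun s => (min_le_right _ _).trans_lt (hy₀ s)
    rw [hconst (min Y y₀) (hm x)]
    have hd (s : ℝ) : HasDerivAt (fun s => φ s (min Y y₀) + W.c * s) (W.u s (min Y y₀)) s := by
      have := (hφ.hasDerivAt_x s _ (hm s)).add ((hasDerivAt_id s).const_mul W.c)
      simpa using! this
    have := convex_univ.norm_image_sub_le_of_norm_hasDerivWithin_le (x := x) (y := x + W.L)
      (C := ε / W.L) (fun s _ => (hd s).hasDerivWithinAt) (fun s _ => by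
        have := (hY (min Y y₀) (min_le_left _ _) s).le
        rwa [dist_zero_left] at this) (mem_univ _) (mem_univ _)
    simp only [Real.norm_eq_abs, add_sub_cancel_left, abs_of_pos hL, div_mul_cancel₀ _ hL.ne']
      at this
    convert this using 2
    ring
  have := abs_nonpos_iff.1 (le_of_forall_pos_le_add fun ε hε =>
    (hsmall ε hε).trans_eq (zero_add ε).symm)
  linarith

theorem sub_L_mem {z : ℂ} (hz : z ∈ W.fluidDomain) : z - W.L ∈ W.fluidDomain := by
  have h : z.im < W.η z.re := hz
  have := W.η_periodic (z.re - W.L)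
  rw [sub_add_cancel] at this
  simpa [fluidDomain, ← this] using h

theorem hodograph_sub_L (hψ : W.IsStreamFunction ψ) (hφ : W.IsVelocityPotential φ) {z : ℂ}
    (hz : z ∈ W.fluidDomain) :
    hodograph φ ψ (z - W.L) = hodograph φ ψ z + (W.c * W.L : ℝ) := by
  have h : z.im < W.η (z.re - W.L) := by simpa [fluidDomain] using sub_L_mem hz
  have h1 := hψ.add_L h
  have h2 := hφ.add_L h
  rw [sub_add_cancel] at h1 h2
  simp only [hodograph, Complex.sub_re, Complex.ofReal_re, Complex.sub_im, Complex.ofReal_im,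
    sub_zero, ← h1, h2]
  push_cast
  ring

theorem inverseHodograph_add (hψ : W.IsStreamFunction ψ) (hφ : W.IsVelocityPotential φ) {w : ℂ}
    (hw : w ∈ upperHalf) :
    W.inverseHodograph φ ψ (w + (W.c * W.L : ℝ)) = W.inverseHodograph φ ψ w - W.L := by
  have hz := inverseHodograph_mem hψ hφ hw
  have := hodograph_sub_L hψ hφ hz
  rw [hodograph_inverseHodograph hψ hφ hw] at this
  rw [← this, inverseHodograph_hodograph hψ hφ (sub_L_mem hz)]

theorem complexVelocity_sub_L {z : ℂ} (hz : z ∈ W.fluidDomain) :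
    W.complexVelocity (z - W.L) = W.complexVelocity z := by
  have h : z.im < W.η (z.re - W.L) := by simpa [fluidDomain] using sub_L_mem hz
  have h1 := W.u_periodic _ _ h.le
  have h2 := W.v_periodic _ _ h.le
  rw [sub_add_cancel] at h1 h2
  simp [complexVelocity, h1, h2]

/-- The complex velocity in the hodograph plane. -/
def hodographVelocity (W : DeepWaterStokesWave) (φ ψ : ℝ → ℝ → ℝ) (w : ℂ) : ℂ :=
  W.complexVelocity (W.inverseHodograph φ ψ w)

theorem hodographVelocity_ne_zero (hψ : W.IsStreamFunction ψ) (hφ : W.IsVelocityPotential φ)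
    {w : ℂ} (hw : w ∈ upperHalf) : W.hodographVelocity φ ψ w ≠ 0 :=
  complexVelocity_ne_zero (inverseHodograph_mem hψ hφ hw)

theorem add_period_mem {w : ℂ} : w + (W.c * W.L : ℝ) ∈ upperHalf ↔ w ∈ upperHalf := by
  simp [upperHalf]

theorem hodographVelocity_add (hψ : W.IsStreamFunction ψ) (hφ : W.IsVelocityPotential φ) {w : ℂ}
    (hw : w ∈ upperHalf) :
    W.hodographVelocity φ ψ (w + (W.c * W.L : ℝ)) = W.hodographVelocity φ ψ w := by
  rw [hodographVelocity, inverseHodograph_add hψ hφ hw,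
    complexVelocity_sub_L (inverseHodograph_mem hψ hφ hw), hodographVelocity]

theorem continuousOn_hodographVelocity (hψ : W.IsStreamFunction ψ) (hφ : W.IsVelocityPotential φ) :
    ContinuousOn (W.hodographVelocity φ ψ) upperHalf :=
  W.continuousOn_complexVelocity.comp
    (fun _ hw => (hasDerivAt_inverseHodograph hψ hφ hw).continuousAt.continuousWithinAt)
    fun _ hw => inverseHodograph_mem hψ hφ hw

/-- The lower bound keeps `J = 1 + c/f` bounded; the upper bound keeps the travel-time density away
from zero, so that the travel time covers the whole line. -/
theorem exists_norm_complexVelocity_bounds (W : DeepWaterStokesWave) :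
    ∃ δ > 0, ∃ C > 0, ∀ z ∈ W.fluidDomain,
      δ ≤ ‖W.complexVelocity z‖ ∧ ‖W.complexVelocity z‖ ≤ C := by
  obtain ⟨δ, hδ, hle⟩ := W.exists_u_le_sub
  obtain ⟨B, hB⟩ := W.bounded
  have hc := W.c_pos
  refine ⟨δ, hδ, |B| + W.c + |B|, by positivity, fun z hz => ⟨?_, ?_⟩⟩
  · have h1 := Complex.abs_re_le_norm (W.complexVelocity z)
    rw [complexVelocity_re] at h1
    have h2 := neg_le_abs (W.u z.re z.im - W.c)
    linarith [hle z.re z.im (le_of_lt hz)]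
  · have h1 := Complex.norm_le_abs_re_add_abs_im (W.complexVelocity z)
    rw [complexVelocity_re, complexVelocity_im, abs_neg] at h1
    obtain ⟨hu, hv⟩ := hB z.re z.im hz
    have h2 := abs_sub (W.u z.re z.im) W.c
    rw [abs_of_pos hc] at h2
    linarith [le_abs_self B]

theorem energyFunction_eq (hψ : W.IsStreamFunction ψ) (hφ : W.IsVelocityPotential φ) {w : ℂ}
    (hw : w ∈ upperHalf) :
    W.energyFunction (hodograph φ ψ) w = 1 + W.c * (W.hodographVelocity φ ψ w)⁻¹ := by
  have := (hasDerivAt_inverseHodograph hψ hφ hw).deriv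
  rw [inverseHodograph] at this
  rw [energyFunction, this]
  rfl

theorem analyticOnNhd_energyFunction (hψ : W.IsStreamFunction ψ) (hφ : W.IsVelocityPotential φ) :
    AnalyticOnNhd ℂ (W.energyFunction (hodograph φ ψ)) upperHalf := by
  have hd : DifferentiableOn ℂ (W.inverseHodograph φ ψ) upperHalf := fun w hw =>
    (hasDerivAt_inverseHodograph hψ hφ hw).differentiableAt.differentiableWithinAt
  exact analyticOnNhd_const.add (analyticOnNhd_const.mul (hd.analyticOnNhd isOpen_upperHalf).deriv)

theorem line_mem {p : ℝ} (hp : 0 < p) (q : ℝ) : (q + p * Complex.I : ℂ) ∈ upperHalf := by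
  simpa [upperHalf] using hp

theorem continuous_hodographVelocity_line (hψ : W.IsStreamFunction ψ)
    (hφ : W.IsVelocityPotential φ) {p : ℝ} (hp : 0 < p) :
    Continuous fun q : ℝ => W.hodographVelocity φ ψ (q + p * Complex.I) :=
  (continuousOn_hodographVelocity hψ hφ).comp_continuous (by fun_prop) (line_mem hp)

/-- The density of the travel time with respect to the potential on the streamline `ψ = p`. -/
def travelTimeDensity (W : DeepWaterStokesWave) (φ ψ : ℝ → ℝ → ℝ) (p q : ℝ) : ℝ :=
  (‖W.hodographVelocity φ ψ (q + p * Complex.I)‖ ^ 2)⁻¹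

theorem continuous_travelTimeDensity (hψ : W.IsStreamFunction ψ) (hφ : W.IsVelocityPotential φ)
    {p : ℝ} (hp : 0 < p) : Continuous (W.travelTimeDensity φ ψ p) :=
  ((continuous_hodographVelocity_line hψ hφ hp).norm.pow 2).inv₀ fun q =>
    pow_ne_zero 2 (norm_ne_zero_iff.2 (hodographVelocity_ne_zero hψ hφ (line_mem hp q)))

theorem exists_le_travelTimeDensity (hψ : W.IsStreamFunction ψ) (hφ : W.IsVelocityPotential φ)
    {p : ℝ} (hp : 0 < p) : ∃ m > 0, ∀ q, m ≤ W.travelTimeDensity φ ψ p q := by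
  obtain ⟨δ, hδ, C, hC, hb⟩ := W.exists_norm_complexVelocity_bounds
  refine ⟨(C ^ 2)⁻¹, by positivity, fun q => ?_⟩
  obtain ⟨h1, h2⟩ := hb _ (inverseHodograph_mem hψ hφ (line_mem hp q))
  have : 0 < ‖W.hodographVelocity φ ψ (q + p * Complex.I)‖ := hδ.trans_le h1
  have h2' : ‖W.hodographVelocity φ ψ (q + p * Complex.I)‖ ≤ C := h2
  unfold travelTimeDensity
  gcongr

theorem line_add_period (p q : ℝ) : (((q + W.c * W.L : ℝ) : ℂ) + p * Complex.I) =
    (q + p * Complex.I) + (W.c * W.L : ℝ) := by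
  push_cast; ring

theorem travelTimeDensity_periodic (hψ : W.IsStreamFunction ψ) (hφ : W.IsVelocityPotential φ)
    {p : ℝ} (hp : 0 < p) : Function.Periodic (W.travelTimeDensity φ ψ p) (W.c * W.L) := fun q => by
  rw [travelTimeDensity, line_add_period, hodographVelocity_add hψ hφ (line_mem hp q),
    travelTimeDensity]

/-! ### Particle paths, their period and their energies. -/

/-- The position in the moving frame, as a complex number, of a particle with path `(X, Y)`. -/
def movingPosition (W : DeepWaterStokesWave) (X Y : ℝ → ℝ) (t : ℝ) : ℂ :=
  (X t - W.c * t : ℝ) + (Y t : ℝ) * Complex.I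

@[simp] theorem movingPosition_re (X Y : ℝ → ℝ) (t : ℝ) :
    (W.movingPosition X Y t).re = X t - W.c * t := by
  simp [movingPosition]

@[simp] theorem movingPosition_im (X Y : ℝ → ℝ) (t : ℝ) :
    (W.movingPosition X Y t).im = Y t := by
  simp [movingPosition]

theorem IsParticlePath.movingPosition_mem {x₀ y₀ : ℝ} {X Y : ℝ → ℝ}
    (h : W.IsParticlePath x₀ y₀ X Y) (t : ℝ) : W.movingPosition X Y t ∈ W.fluidDomain := by
  simpa [fluidDomain] using h.mem t

theorem IsParticlePath.hasDerivAt_movingPosition {x₀ y₀ : ℝ} {X Y : ℝ → ℝ}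
    (h : W.IsParticlePath x₀ y₀ X Y) (t : ℝ) :
    HasDerivAt (W.movingPosition X Y)
      (starRingEnd ℂ (W.complexVelocity (W.movingPosition X Y t))) t := by
  have h1 := (h.hasDerivAt_X t).sub ((hasDerivAt_id t).const_mul W.c)
  have h2 := h1.ofReal_comp.add ((h.hasDerivAt_Y t).ofReal_comp.mul_const Complex.I)
  convert! h2 using 1
  apply Complex.ext <;> simp

/-- A path of a particle whose initial position has the hodograph coordinate `q₀ + i p` is given by
the inverse hodograph transform and by the inverse `σ` of the travel time `τ`. -/
theorem isParticlePath_iff (hψ : W.IsStreamFunction ψ) (hφ : W.IsVelocityPotential φ)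
    {p : ℝ} (hp : 0 < p) {τ σ : ℝ → ℝ}
    (hτ : ∀ q, HasDerivAt τ (W.travelTimeDensity φ ψ p q) q)
    (hσ : ∀ t, HasDerivAt σ (W.travelTimeDensity φ ψ p (σ t))⁻¹ t) (hστ : ∀ q, σ (τ q) = q)
    {x₀ y₀ q₀ : ℝ} (hz₀ : y₀ < W.η x₀)
    (hq₀ : hodograph φ ψ (x₀ + y₀ * Complex.I) = q₀ + p * Complex.I) (X Y : ℝ → ℝ) :
    W.IsParticlePath x₀ y₀ X Y ↔ ∀ t, W.movingPosition X Y t =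
      W.inverseHodograph φ ψ (σ (τ q₀ + t) + p * Complex.I) := by
  have hmem₀ : (x₀ + y₀ * Complex.I : ℂ) ∈ W.fluidDomain := by simpa [fluidDomain] using hz₀
  constructor
  · intro h
    let H : ℝ → ℂ := fun t => hodograph φ ψ (W.movingPosition X Y t)
    -- The derivative `f · conj f` is real: `ψ` is conserved and `φ` grows at rate `|f|²`.
    have hH (t : ℝ) : HasDerivAt H
        ((‖W.complexVelocity (W.movingPosition X Y t)‖ ^ 2 : ℝ) : ℂ) t := by
      have := (hasDerivAt_hodograph hψ hφ (h.movingPosition_mem t)).comp t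
        (h.hasDerivAt_movingPosition t)
      rwa [Complex.mul_conj, Complex.normSq_eq_norm_sq] at this
    have hH0 : H 0 = q₀ + p * Complex.I := by
      rw [← hq₀]
      simp [H, movingPosition, h.X_zero, h.Y_zero]
    have him (t : ℝ) : (H t).im = p := by
      have hd (t : ℝ) : HasDerivAt (fun t => (H t).im) 0 t := by
        have := Complex.imCLM.hasFDerivAt.comp_hasDerivAt t (hH t)
        rwa [Complex.imCLM_apply, Complex.ofReal_im] at this
      have := is_const_of_deriv_eq_zero (fun t => (hd t).differentiableAt) (fun t => (hd t).deriv)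
        t 0
      simpa [hH0] using this
    have hHt (t : ℝ) : H t = (H t).re + p * Complex.I := by
      rw [← him t, Complex.re_add_im]
    have hZ (t : ℝ) : W.movingPosition X Y t =
        W.inverseHodograph φ ψ ((H t).re + p * Complex.I) := by
      rw [← hHt, inverseHodograph_hodograph hψ hφ (h.movingPosition_mem t)]
    have hre (t : ℝ) : HasDerivAt (fun t => (H t).re)
        (W.travelTimeDensity φ ψ p (H t).re)⁻¹ t := by
      have := Complex.reCLM.hasFDerivAt.comp_hasDerivAt t (hH t)
      rw [hZ t] at this
      simpa only [travelTimeDensity, inv_inv] using! this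
    have hτH (t : ℝ) : τ (H t).re = τ q₀ + t := by
      -- Separation of variables: the travel time `τ` increases at unit rate along the path.
      have hd (t : ℝ) : HasDerivAt (fun t => τ (H t).re - t) 0 t := by
        have hne : W.travelTimeDensity φ ψ p (H t).re ≠ 0 :=
          inv_ne_zero (pow_ne_zero 2 (norm_ne_zero_iff.2
            (hodographVelocity_ne_zero hψ hφ (line_mem hp _))))
        have := ((hτ (H t).re).comp t (hre t)).sub (hasDerivAt_id t)
        rwa [mul_inv_cancel₀ hne, sub_self] at this
      have := is_const_of_deriv_eq_zero (fun t => (hd t).differentiableAt) (fun t => (hd t).deriv)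
        t 0
      simp only [hH0, sub_zero, Complex.add_re, Complex.ofReal_re, Complex.mul_re, Complex.I_re,
        mul_zero, Complex.ofReal_im, Complex.I_im, zero_mul, add_zero] at this
      linarith
    intro t
    rw [hZ t, ← hτH t, hστ]
  · intro h
    have hm (t : ℝ) : W.movingPosition X Y t ∈ W.fluidDomain := by
      rw [h t]
      exact inverseHodograph_mem hψ hφ (line_mem hp _)
    have hd (t : ℝ) : HasDerivAt (W.movingPosition X Y)
        (starRingEnd ℂ (W.complexVelocity (W.movingPosition X Y t))) t := by
      have h1 : HasDerivAt (fun t => (σ (τ q₀ + t) : ℂ) + p * Complex.I)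
          (((W.travelTimeDensity φ ψ p (σ (τ q₀ + t)))⁻¹ : ℝ) : ℂ) t :=
        (((hσ (τ q₀ + t)).comp_const_add (τ q₀) t).ofReal_comp).add_const _
      have h2 := (hasDerivAt_inverseHodograph hψ hφ
        (line_mem hp (σ (τ q₀ + t)))).comp t h1
      rw [funext h]
      convert! h2 using 1
      rw [travelTimeDensity, inv_inv, hodographVelocity, ← Complex.normSq_eq_norm_sq,
        ← Complex.mul_conj, inv_mul_cancel_left₀]
      exact complexVelocity_ne_zero (inverseHodograph_mem hψ hφ (line_mem hp _))
    have h0 : W.movingPosition X Y 0 = x₀ + y₀ * Complex.I := by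
      rw [h 0, add_zero, hστ, ← hq₀, inverseHodograph_hodograph hψ hφ hmem₀]
    refine ⟨fun t => by simpa [fluidDomain] using hm t, fun t => ?_, fun t => ?_, ?_, ?_⟩
    · have := (Complex.reCLM.hasFDerivAt.comp_hasDerivAt t (hd t)).add
        ((hasDerivAt_id t).const_mul W.c)
      convert! this using 1
      · funext s; simp
      · simp
    · have := Complex.imCLM.hasFDerivAt.comp_hasDerivAt t (hd t)
      convert! this using 1
      · funext s; simp
      · simp
    · simpa using congrArg Complex.re h0
    · simpa using congrArg Complex.im h0

/-- The explicit formula of `isParticlePath_iff` is at once a solution and the only one, for all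
times. -/
theorem existsUnique_isParticlePath (hψ : W.IsStreamFunction ψ) (hφ : W.IsVelocityPotential φ)
    {x₀ y₀ : ℝ} (hz₀ : y₀ < W.η x₀) :
    ∃! γ : (ℝ → ℝ) × (ℝ → ℝ), W.IsParticlePath x₀ y₀ γ.1 γ.2 := by
  have hp := hψ.pos hz₀
  obtain ⟨m, hm, hmG⟩ := exists_le_travelTimeDensity hψ hφ hp
  obtain ⟨τ, σ, -, hτ, hσ, hστ, -⟩ :=
    exists_timeChange (continuous_travelTimeDensity hψ hφ hp) hm hmG
  have hiff := isParticlePath_iff hψ hφ hp hτ hσ hστ (q₀ := φ x₀ y₀) hz₀ (by simp [hodograph])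
  let Z : ℝ → ℂ := fun t => W.inverseHodograph φ ψ (σ (τ (φ x₀ y₀) + t) + ψ x₀ y₀ * Complex.I)
  refine ⟨(fun t => (Z t).re + W.c * t, fun t => (Z t).im), (hiff _ _).2 fun t => ?_, ?_⟩
  · simp [movingPosition, Z]
  · rintro ⟨X, Y⟩ h
    have h' := (hiff X Y).1 h
    ext t
    · have := congrArg Complex.re (h' t)
      rw [movingPosition_re] at this
      simp only [Z, ← this]
      ring
    · have := congrArg Complex.im (h' t)
      rw [movingPosition_im] at this
      simp only [Z, ← this]

theorem IsParticlePath.movingPosition_re_strictAnti {x₀ y₀ : ℝ} {X Y : ℝ → ℝ}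
    (h : W.IsParticlePath x₀ y₀ X Y) : StrictAnti fun t => X t - W.c * t := by
  refine strictAnti_of_deriv_neg fun t => ?_
  have := (h.hasDerivAt_X t).sub ((hasDerivAt_id t).const_mul W.c)
  rw [HasDerivAt.deriv (f := fun t => X t - W.c * t) this]
  linarith [W.u_lt_c _ _ (h.mem t).le]

/-- The streamline time-period and the kinetic energies over it, in terms of the velocity in the
hodograph plane. -/
theorem IsParticlePath.period_and_energy (hψ : W.IsStreamFunction ψ)
    (hφ : W.IsVelocityPotential φ) {x₀ y₀ : ℝ} {X Y : ℝ → ℝ} (hz₀ : y₀ < W.η x₀)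
    (h : W.IsParticlePath x₀ y₀ X Y) {T : ℝ}
    (hT : T = ∫ q in (0 : ℝ)..(W.c * W.L), W.travelTimeDensity φ ψ (ψ x₀ y₀) q) :
    (∀ T', W.IsStreamlineTimePeriod X T' ↔ T' = T) ∧
    totalKineticEnergy X Y T = 1 / 2 * ∫ q in (0 : ℝ)..(W.c * W.L),
      ‖W.energyFunction (hodograph φ ψ) (q + ψ x₀ y₀ * Complex.I)‖ ^ 2 ∧
    W.movingTotalKineticEnergy X Y T = W.c * W.L / 2 := by
  have hp := hψ.pos hz₀
  have hcL : 0 < W.c * W.L := mul_pos W.c_pos W.L_pos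
  set p := ψ x₀ y₀
  set q₀ := φ x₀ y₀
  have hG := continuous_travelTimeDensity hψ hφ hp
  obtain ⟨m, hm, hmG⟩ := exists_le_travelTimeDensity hψ hφ hp
  obtain ⟨τ, σ, hτI, hτ, hσ, hστ, -⟩ := exists_timeChange hG hm hmG
  have hZ := (isParticlePath_iff hψ hφ hp hτ hσ hστ (q₀ := q₀) hz₀ (by simp [hodograph, p, q₀])
    X Y).1 h
  -- The density is periodic, so crossing one period takes the same time `T` from any `q₀`.
  have hτT : τ (q₀ + W.c * W.L) = τ q₀ + T := by
    have h1 := (travelTimeDensity_periodic hψ hφ hp).intervalIntegral_add_eq q₀ 0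
    rw [zero_add] at h1
    rw [hτI, hτI, hT, ← h1, intervalIntegral.integral_add_adjacent_intervals
      (hG.intervalIntegrable _ _) (hG.intervalIntegrable _ _)]
  let Q : ℝ → ℝ := fun t => σ (τ q₀ + t)
  have hQ0 : Q 0 = q₀ := by simp [Q, hστ]
  have hQT : Q T = q₀ + W.c * W.L := by simp only [Q]; rw [← hτT, hστ]
  have hQ (t : ℝ) : HasDerivAt Q (W.travelTimeDensity φ ψ p (Q t))⁻¹ t :=
    (hσ (τ q₀ + t)).comp_const_add (τ q₀) t
  have hQc : Continuous Q := continuous_iff_continuousAt.2 fun t => (hQ t).continuousAt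
  have hQ'c : Continuous fun t => (W.travelTimeDensity φ ψ p (Q t))⁻¹ :=
    (hG.comp hQc).inv₀ fun t => (hm.trans_le (hmG _)).ne'
  have hTpos : 0 < T := by
    rw [hT]
    exact intervalIntegral.intervalIntegral_pos_of_pos (hG.intervalIntegrable _ _)
      (fun q => hm.trans_le (hmG q)) hcL
  have hvel (t : ℝ) : W.complexVelocity (W.movingPosition X Y t) =
      W.hodographVelocity φ ψ (Q t + p * Complex.I) := by rw [hZ t]; rfl
  have hX (t : ℝ) : deriv X t = (W.complexVelocity (W.movingPosition X Y t)).re + W.c := by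
    simp [(h.hasDerivAt_X t).deriv]
  have hY (t : ℝ) : deriv Y t = -(W.complexVelocity (W.movingPosition X Y t)).im := by
    simp [(h.hasDerivAt_Y t).deriv]
  have hper : X T - W.c * T = X 0 - W.L := by
    have h0 := hZ 0
    have h1 := hZ T
    simp only [Q] at hQT hQ0
    rw [hQT, line_add_period, inverseHodograph_add hψ hφ (line_mem hp q₀)] at h1
    rw [hQ0] at h0
    rw [← h0] at h1
    simpa using congrArg Complex.re h1
  refine ⟨fun T' => ⟨fun hT' => ?_, fun hT' => hT' ▸ ⟨hTpos, hper⟩⟩, ?_, ?_⟩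
  · exact h.movingPosition_re_strictAnti.injective (hT'.2.trans hper.symm)
  · have hJ : Continuous fun q : ℝ =>
        ‖W.energyFunction (hodograph φ ψ) (q + p * Complex.I)‖ ^ 2 :=
      ((analyticOnNhd_energyFunction hψ hφ).continuousOn.comp_continuous (by fun_prop)
        (line_mem hp)).norm.pow 2
    -- Substitution `q = Q(t)`, `dq = |f|² dt`; the integrands match because `|J|² |f|² = |f + c|² =
    -- x'² + y'²`.
    have hsub := intervalIntegral.integral_comp_mul_deriv (a := 0) (b := T)
      (fun t _ => hQ t) hQ'c.continuousOn hJ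
    have hJper : Function.Periodic (fun q : ℝ =>
        ‖W.energyFunction (hodograph φ ψ) (q + p * Complex.I)‖ ^ 2) (W.c * W.L) := fun q => by
      simp only
      rw [line_add_period, energyFunction_eq hψ hφ (add_period_mem.2 (line_mem hp q)),
        hodographVelocity_add hψ hφ (line_mem hp q), energyFunction_eq hψ hφ (line_mem hp q)]
    have h1 := hJper.intervalIntegral_add_eq q₀ 0
    rw [zero_add] at h1
    rw [hQ0, hQT, h1] at hsub
    rw [totalKineticEnergy, ← hsub]
    congr 1
    refine intervalIntegral.integral_congr fun t _ => ?_
    have hne := hodographVelocity_ne_zero hψ hφ (line_mem hp (Q t))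
    simp only [Function.comp_apply]
    rw [hX, hY, hvel, energyFunction_eq hψ hφ (line_mem hp (Q t)), travelTimeDensity, inv_inv,
      ← mul_pow, ← norm_mul, add_mul, mul_assoc, inv_mul_cancel₀ hne, ← Complex.normSq_eq_norm_sq,
      Complex.normSq_apply]
    simp
    ring
  -- Here the integrand `|f|²` is `Q'` itself, so the integral is the increment `cλ` of the
  -- potential.
  · have hsub := intervalIntegral.integral_eq_sub_of_hasDerivAt (a := 0) (b := T)
      (fun t _ => hQ t) (hQ'c.intervalIntegrable _ _)
    rw [hQ0, hQT, add_sub_cancel_left] at hsub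
    rw [movingTotalKineticEnergy, show W.c * W.L / 2 = 1 / 2 * (W.c * W.L) by ring, ← hsub]
    congr 1
    refine intervalIntegral.integral_congr fun t _ => ?_
    rw [hX, hY, hvel, travelTimeDensity, inv_inv, ← Complex.normSq_eq_norm_sq,
      Complex.normSq_apply]
    ring

/-! ### The energy function on the unit disk and the energy as a series. -/

/-- Otherwise `v = 0` up to the surface by continuity, the kinematic condition with `u < c` gives
`η' = 0`, and the surface could not rise from trough to crest. -/
theorem exists_v_ne_zero (W : DeepWaterStokesWave) : ∃ x y, y < W.η x ∧ W.v x y ≠ 0 := by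
  by_contra! hv
  have hs (x : ℝ) : W.v x (W.η x) = 0 := by
    have hc : ContinuousOn (W.v x) (Iic (W.η x)) :=
      W.continuousOn_v.comp (f := fun s : ℝ => (x, s)) (by fun_prop) fun s hs => hs
    have h1 : Tendsto (W.v x) (𝓝[<] (W.η x)) (𝓝 (W.v x (W.η x))) :=
      (hc _ self_mem_Iic).mono_left (nhdsWithin_mono _ Iio_subset_Iic_self)
    refine tendsto_nhds_unique h1 (tendsto_const_nhds.congr' ?_)
    filter_upwards [self_mem_nhdsWithin] with y hy using (hv x y hy).symm
  have hd (x : ℝ) : deriv W.η x = 0 := by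
    have := W.kinematic x
    rw [hs] at this
    exact (mul_eq_zero.1 this.symm).resolve_left (sub_neg.2 (W.u_lt_c _ _ le_rfl)).ne
  have hL := W.L_pos
  have h1 := W.η_strictMonoOn (a := -(W.L / 2)) (b := 0) ⟨le_rfl, by linarith⟩
    ⟨by linarith, le_rfl⟩ (by linarith)
  exact h1.ne (is_const_of_deriv_eq_zero W.differentiable_η hd _ _)

/-- A zero of `J` means `f = -c`, which is impossible where `v ≠ 0`. This makes the energy strictly
positive. -/
theorem exists_energyFunction_ne_zero (hψ : W.IsStreamFunction ψ) (hφ : W.IsVelocityPotential φ) :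
    ∃ w ∈ upperHalf, W.energyFunction (hodograph φ ψ) w ≠ 0 := by
  obtain ⟨x, y, hy, hv⟩ := W.exists_v_ne_zero
  have hz : (x + y * Complex.I : ℂ) ∈ W.fluidDomain := by simpa [fluidDomain] using hy
  have hw := (bijOn_hodograph hψ hφ).mapsTo hz
  refine ⟨_, hw, fun h => hv ?_⟩
  rw [energyFunction_eq hψ hφ hw, hodographVelocity, inverseHodograph_hodograph hψ hφ hz] at h
  have hne := complexVelocity_ne_zero hz
  have h2 : W.complexVelocity (x + y * Complex.I) = -W.c := by
    field_simp at h
    linear_combination h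
  simpa using congrArg Complex.im h2

/-- The energy function, extended by zero to a periodic function on the whole plane. -/
def periodicEnergyFunction (W : DeepWaterStokesWave) (φ ψ : ℝ → ℝ → ℝ) : ℂ → ℂ :=
  upperHalf.indicator (W.energyFunction (hodograph φ ψ))

theorem periodicEnergyFunction_periodic (hψ : W.IsStreamFunction ψ)
    (hφ : W.IsVelocityPotential φ) :
    Function.Periodic (W.periodicEnergyFunction φ ψ) ((W.c * W.L : ℝ) : ℂ) := fun w => by
  by_cases hw : w ∈ upperHalf
  · have hw' := add_period_mem (W := W).2 hw
    rw [periodicEnergyFunction, indicator_of_mem hw, indicator_of_mem hw',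
      energyFunction_eq hψ hφ hw, energyFunction_eq hψ hφ hw', hodographVelocity_add hψ hφ hw]
  · have hw' := mt (add_period_mem (W := W)).1 hw
    rw [periodicEnergyFunction, indicator_of_notMem hw, indicator_of_notMem hw']

theorem differentiableAt_periodicEnergyFunction (hψ : W.IsStreamFunction ψ)
    (hφ : W.IsVelocityPotential φ) {w : ℂ} (hw : w ∈ upperHalf) :
    DifferentiableAt ℂ (W.periodicEnergyFunction φ ψ) w := by
  refine (analyticOnNhd_energyFunction hψ hφ w hw).differentiableAt.congr_of_eventuallyEq ?_
  filter_upwards [isOpen_upperHalf.mem_nhds hw] with w hw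
  exact indicator_of_mem hw _

/-- The energy function as a function on the unit disk. -/
def diskEnergyFunction (W : DeepWaterStokesWave) (φ ψ : ℝ → ℝ → ℝ) : ℂ → ℂ :=
  Function.Periodic.cuspFunction (W.c * W.L) (W.periodicEnergyFunction φ ψ)

theorem diskEnergyFunction_exp (hψ : W.IsStreamFunction ψ) (hφ : W.IsVelocityPotential φ) {w : ℂ}
    (hw : w ∈ upperHalf) :
    W.diskEnergyFunction φ ψ (Complex.exp (Complex.I * W.waveNumber * w)) =
      W.energyFunction (hodograph φ ψ) w := by
  have hcL := mul_pos W.c_pos W.L_pos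
  have := Function.Periodic.eq_cuspFunction hcL.ne' (periodicEnergyFunction_periodic hψ hφ) w
  rw [periodicEnergyFunction, indicator_of_mem hw] at this
  rw [← this, diskEnergyFunction, Function.Periodic.qParam, waveNumber]
  congr 2
  push_cast
  ring

/-- Away from the origin, `e^{ikw}` is locally invertible and `J` is holomorphic. At the origin, the
bound `1 + c/δ` on `|J|` makes the singularity removable. -/
theorem differentiableOn_diskEnergyFunction (hψ : W.IsStreamFunction ψ)
    (hφ : W.IsVelocityPotential φ) :
    DifferentiableOn ℂ (W.diskEnergyFunction φ ψ) (Metric.ball 0 1) := by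
  intro ζ hζ
  have hcL := mul_pos W.c_pos W.L_pos
  have hper := periodicEnergyFunction_periodic hψ hφ
  refine DifferentiableAt.differentiableWithinAt ?_
  have hev : ∀ᶠ w in comap Complex.im atTop, w ∈ upperHalf :=
    (eventually_gt_atTop (0 : ℝ)).comap _
  rcases eq_or_ne ζ 0 with rfl | h0
  · refine Function.Periodic.differentiableAt_cuspFunction_zero hcL hper ?_ ?_
    · filter_upwards [hev] with w hw using differentiableAt_periodicEnergyFunction hψ hφ hw
    · obtain ⟨δ, hδ, C, -, hb⟩ := W.exists_norm_complexVelocity_bounds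
      refine Asymptotics.IsBigO.of_bound (1 + W.c * δ⁻¹) ?_
      filter_upwards [hev] with w hw
      have h1 := (hb _ (inverseHodograph_mem hψ hφ hw)).1
      rw [periodicEnergyFunction, indicator_of_mem hw, energyFunction_eq hψ hφ hw]
      refine (norm_add_le _ _).trans ?_
      rw [norm_mul, norm_inv, Complex.norm_real, Real.norm_of_nonneg W.c_pos.le, hodographVelocity]
      have := W.c_pos
      simp only [norm_one, Pi.one_apply, mul_one]
      gcongr
  · rw [diskEnergyFunction, ← Function.Periodic.qParam_right_inv hcL.ne' h0]
    refine Function.Periodic.differentiableAt_cuspFunction hcL.ne' hper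
      (differentiableAt_periodicEnergyFunction hψ hφ ?_)
    rw [upperHalf, mem_ofPred_eq, ← Function.Periodic.norm_qParam_lt_iff hcL,
      Function.Periodic.qParam_right_inv hcL.ne' h0]
    simpa using hζ

theorem integralMean_sq (F : ℂ → ℂ) (r : ℝ) : integralMean 2 F r ^ 2 =
    (1 / (2 * Real.pi)) *
      ∫ θ in (0 : ℝ)..(2 * Real.pi), ‖F (r * Complex.exp (θ * Complex.I))‖ ^ 2 := by
  have h0 : 0 ≤ (1 / (2 * Real.pi)) *
      ∫ θ in (0 : ℝ)..(2 * Real.pi), ‖F (r * Complex.exp (θ * Complex.I))‖ ^ 2 :=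
    mul_nonneg (by positivity)
      (intervalIntegral.integral_nonneg (by positivity) fun θ _ => by positivity)
  simp only [integralMean, Real.rpow_two]
  rw [← Real.sqrt_eq_rpow, Real.sq_sqrt h0]

/-- The kinetic energy on a streamline as a quadratic integral mean over a circle. -/
theorem integral_sq_norm_energyFunction (hψ : W.IsStreamFunction ψ) (hφ : W.IsVelocityPotential φ)
    {p : ℝ} (hp : 0 < p) :
    1 / 2 * ∫ q in (0 : ℝ)..(W.c * W.L),
      ‖W.energyFunction (hodograph φ ψ) (q + p * Complex.I)‖ ^ 2 =
    W.c * W.L / 2 *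
      integralMean 2 (W.diskEnergyFunction φ ψ) (Real.exp (-(W.waveNumber * p))) ^ 2 := by
  have hcL := mul_pos W.c_pos W.L_pos
  have hk : 0 < W.waveNumber := div_pos (by positivity) hcL
  have hkL : 2 * Real.pi / W.waveNumber = W.c * W.L := by
    rw [waveNumber, div_div_cancel₀]; positivity
  -- The circle of radius `e^{-kp}` is the image of the line `Im w = p`, with `θ = kq`.
  have hcirc (θ : ℝ) : W.diskEnergyFunction φ ψ
      (Real.exp (-(W.waveNumber * p)) * Complex.exp (θ * Complex.I)) =
      W.energyFunction (hodograph φ ψ) ((θ / W.waveNumber : ℝ) + p * Complex.I) := by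
    rw [← diskEnergyFunction_exp hψ hφ (line_mem hp _), Complex.ofReal_exp, ← Complex.exp_add]
    congr 2
    have : (W.waveNumber : ℂ) ≠ 0 := by exact_mod_cast hk.ne'
    push_cast
    field_simp
    linear_combination (-(W.waveNumber * p : ℂ)) * Complex.I_sq
  rw [integralMean_sq]
  simp only [hcirc]
  rw [intervalIntegral.integral_comp_div (fun q : ℝ =>
    ‖W.energyFunction (hodograph φ ψ) (q + p * Complex.I)‖ ^ 2) hk.ne', zero_div, hkL, smul_eq_mul,
    ← mul_assoc, ← mul_assoc]
  congr 1
  rw [← hkL]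
  field_simp

/-- The kinetic energy as a Dirichlet series with nonnegative coefficients. -/
theorem exists_hasSum_energy (hψ : W.IsStreamFunction ψ) (hφ : W.IsVelocityPotential φ) :
    ∃ b : ℕ → ℝ, (∀ n, 0 ≤ b n) ∧ (∃ n, 0 < b n) ∧
      ∀ p > 0, HasSum (fun n => b n * Real.exp (-(2 * W.waveNumber * n * p)))
        (1 / 2 * ∫ q in (0 : ℝ)..(W.c * W.L),
          ‖W.energyFunction (hodograph φ ψ) (q + p * Complex.I)‖ ^ 2) := by
  have hcL := mul_pos W.c_pos W.L_pos
  have hk : 0 < W.waveNumber := div_pos (by positivity) hcL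
  let a : ℕ → ℂ := fun n =>
    (n.factorial : ℂ)⁻¹ * iteratedDeriv n (W.diskEnergyFunction φ ψ) 0
  have ha : ∀ ζ ∈ Metric.ball (0 : ℂ) 1,
      HasSum (fun n => a n * ζ ^ n) (W.diskEnergyFunction φ ψ ζ) := fun ζ hζ => by
    have := Complex.hasSum_taylorSeries_on_ball (differentiableOn_diskEnergyFunction hψ hφ) hζ
    convert! this using 1
    funext n
    simp only [a, sub_zero, smul_eq_mul]
    ring
  refine ⟨fun n => W.c * W.L / 2 * ‖a n‖ ^ 2, fun n => by positivity, ?_, fun p hp => ?_⟩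
  -- If all Taylor coefficients vanished, `J` would vanish identically.
  · by_contra! hb
    have ha0 (n : ℕ) : a n = 0 := by
      have h1 : ‖a n‖ ^ 2 ≤ 0 := by
        by_contra! h
        exact (hb n).not_gt (mul_pos (by positivity) h)
      simpa using pow_eq_zero_iff two_ne_zero |>.1 (h1.antisymm (by positivity))
    obtain ⟨w, hw, hne⟩ := exists_energyFunction_ne_zero hψ hφ
    rw [← diskEnergyFunction_exp hψ hφ hw] at hne
    have hball : Complex.exp (Complex.I * W.waveNumber * w) ∈ Metric.ball (0 : ℂ) 1 := by
      have hw' : 0 < w.im := hw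
      rw [mem_ball_zero_iff, Complex.norm_exp, Real.exp_lt_one_iff]
      simpa using mul_pos hk hw'
    refine hne ((ha _ hball).unique ?_)
    simp [ha0]
  · rw [integral_sq_norm_energyFunction hψ hφ hp, integralMean_sq]
    have := (hasSum_sq_norm_coeff_circle ha (Real.exp_nonneg (-(W.waveNumber * p)))
      (Real.exp_lt_one_iff.2 (neg_neg_of_pos (mul_pos hk hp)))).mul_left (W.c * W.L / 2)
    convert! this using 1
    funext n
    rw [← Real.exp_nat_mul, ← mul_assoc]
    congr 2
    push_cast
    ring

end DeepWaterStokesWave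

end

/-! ### The main theorem. -/

theorem theorem5p1 (W : DeepWaterStokesWave) :
    (∃ ψ : ℝ → ℝ → ℝ, W.IsStreamFunction ψ) ∧
    (∃ φ : ℝ → ℝ → ℝ, W.IsVelocityPotential φ) ∧
    ∀ ψ φ : ℝ → ℝ → ℝ, W.IsStreamFunction ψ → W.IsVelocityPotential φ →
      -- the hodograph transform is a bijection of the fluid domain onto the half plane
      Set.BijOn (hodograph φ ψ) W.fluidDomain upperHalf ∧
      -- every streamline `ψ = p`, `p > 0`, is a graph over the horizontal axis
      (∀ p > 0, ∀ x₀ : ℝ, ∃! y₀ : ℝ, y₀ < W.η x₀ ∧ ψ x₀ y₀ = p) ∧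
      -- every particle in the fluid has a unique global path
      (∀ x₀ y₀ : ℝ, y₀ < W.η x₀ →
        ∃! γ : (ℝ → ℝ) × (ℝ → ℝ), W.IsParticlePath x₀ y₀ γ.1 γ.2) ∧
      ∃ 𝓣 𝓔 : ℝ → ℝ,
        -- the time-period and the total kinetic energy depend on the streamline only, and the
        -- total kinetic energy in the moving frame is constant
        (∀ p > 0, ∀ (x₀ y₀ : ℝ) (X Y : ℝ → ℝ), y₀ < W.η x₀ → ψ x₀ y₀ = p →
          W.IsParticlePath x₀ y₀ X Y →
            (∀ T : ℝ, W.IsStreamlineTimePeriod X T ↔ T = 𝓣 p) ∧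
            DeepWaterStokesWave.totalKineticEnergy X Y (𝓣 p) = 𝓔 p ∧
            W.movingTotalKineticEnergy X Y (𝓣 p) = W.c * W.L / 2) ∧
        (∀ p > 0, 0 < 𝓔 p) ∧
        ConvexOn ℝ (Set.Ioi 0) 𝓔 ∧
        AntitoneOn 𝓔 (Set.Ioi 0) ∧
        ConvexOn ℝ (Set.Ioi 0) (fun p => Real.log (𝓔 p)) ∧
        -- the total kinetic energy as a quadratic integral mean of an analytic function
        AnalyticOnNhd ℂ (W.energyFunction (hodograph φ ψ)) upperHalf ∧
        ∃ 𝓙 : ℂ → ℂ, AnalyticOnNhd ℂ 𝓙 (Metric.ball 0 1) ∧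
          (∀ w ∈ upperHalf, 𝓙 (Complex.exp (Complex.I * W.waveNumber * w)) =
            W.energyFunction (hodograph φ ψ) w) ∧
          ∀ p > 0, 𝓔 p =
            W.c * W.L / 2 * integralMean 2 𝓙 (Real.exp (-(W.waveNumber * p))) ^ 2 := by
  refine ⟨W.exists_isStreamFunction, W.exists_isVelocityPotential, fun ψ φ hψ hφ =>
    ⟨DeepWaterStokesWave.bijOn_hodograph hψ hφ, fun p hp x₀ => hψ.existsUnique_streamline hp x₀,
      fun x₀ y₀ h => DeepWaterStokesWave.existsUnique_isParticlePath hψ hφ h, ?_⟩⟩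
  obtain ⟨b, hb, ⟨n, hn⟩, hsum⟩ := DeepWaterStokesWave.exists_hasSum_energy hψ hφ
  have hk : 0 < W.waveNumber := div_pos (by positivity) (mul_pos W.c_pos W.L_pos)
  have hpos (p : ℝ) (hp : 0 < p) := (hsum p hp).summable.tsum_pos
    (fun n => mul_nonneg (hb n) (Real.exp_nonneg _)) n (mul_pos hn (Real.exp_pos _))
  have hpos' : ∀ p : ℝ, p > 0 → 0 < 1 / 2 * ∫ q in (0 : ℝ)..(W.c * W.L),
      ‖W.energyFunction (hodograph φ ψ) (q + p * Complex.I)‖ ^ 2 := fun p hp =>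
    (hsum p hp).tsum_eq ▸ hpos p hp
  have hlog := convexOn_log_of_hasSum_exp hb hsum hpos'
  -- The period is the travel time across one period `cλ` of the potential, and the energy is half
  -- the integral of `|J|²` over it.
  refine ⟨fun p => ∫ q in (0 : ℝ)..(W.c * W.L), W.travelTimeDensity φ ψ p q,
    fun p => 1 / 2 * ∫ q in (0 : ℝ)..(W.c * W.L),
      ‖W.energyFunction (hodograph φ ψ) (q + p * Complex.I)‖ ^ 2, ?_, hpos', hlog.of_log hpos',
    antitoneOn_of_hasSum_exp hb (by positivity) hsum, hlog,
    DeepWaterStokesWave.analyticOnNhd_energyFunction hψ hφ,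
    W.diskEnergyFunction φ ψ,
    (DeepWaterStokesWave.differentiableOn_diskEnergyFunction hψ hφ).analyticOnNhd
      Metric.isOpen_ball,
    fun w hw => DeepWaterStokesWave.diskEnergyFunction_exp hψ hφ hw,
    fun p hp => DeepWaterStokesWave.integral_sq_norm_energyFunction hψ hφ hp⟩
  rintro p - x₀ y₀ X Y hz₀ rfl h
  exact h.period_and_energy hψ hφ hz₀ rfl
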